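/- Let $q\ge 2$ be real and let $\phi:[0,\infty)\to[0,\infty)$ be an Orlicz function, i.e. $\phi(0)=0$, $\phi$ is strictly increasing and continuous, and $\phi(u)\to\infty$ as $u\to\infty$ (convexity is not assumed). Let $(\Omega,\Sigma,\mu)$ be one of the following measure spaces, and attach to it a range of pairs $(a,u)$ with $a\ge 1$, $u\ge 0$: (1) $\mu$ is $\sigma$-finite and non-atomic with $\mu(\Omega)=\infty$ (all arguments: all $u\ge 0$); (2) $\mu$ is non-atomic with $0<\mu(\Omega)<\infty$ (large arguments: $u\ge v$ for some $v\ge 0$ that may depend on $\phi$ and on the exponent); (3) $\Omega=\mathbb N$ with the counting measure (small arguments: $au\le v$ for some $v>0$ that may depend on $\phi$ and on the exponent). With respect to this range, let the lower Matuszewska–Orlicz index $\alpha_\phi\in[0,\infty]$ be the supremum of all $p\in\mathbb R$ for which there is $c>0$ with $\phi(au)\ge c\,a^p\phi(u)$ for all $a,u$ in the range, and write $\phi\in\Delta^q$ if there is $K>0$ with $\phi(au)\le K a^q\phi(u)$ for all $a,u$ in the range. Let $L_\phi$ be the space of all ($\mu$-a.e. classes of) real measurable functions $f$ on $\Omega$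 with $\int_\Omega\phi(\lambda|f|)\,d\mu<\infty$ for some $\lambda>0$, equipped with $\|f\|=\inf\{\varepsilon>0:\int_\Omega\phi(|f|/\varepsilon)\,d\mu\le 1\}$. Say that $L_\phi$ has cotype $q$ if there is a constant $K>0$ such that for all $n$ and all $x_1,\dots,x_n\in L_\phi$ $$\Big(\sum_{k=1}^n\|x_k\|^q\Big)^{1/q}\le K\int_0^1\Big\|\sum_{k=1}^n r_k(t)x_k\Big\|\,dt,$$ where $r_k(t)=\operatorname{sign}(\sin 2^k\pi t)$ are the Rademacher functions. If $\alpha_\phi>0$, then in each of the cases (1), (2), (3), $L_\phi$ has cotype $q$ if and only if $\phi\in\Delta^q$. -/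

import Mathlib

open MeasureTheory
open scoped NNReal ENNReal

universe u

/-- An Orlicz function `φ : ℝ₊ → ℝ₊`: it vanishes at `0`, is strictly increasing, continuous, and
tends to infinity at infinity. Convexity is not required. -/
structure OrliczFunction where
  toFun : ℝ≥0 → ℝ≥0
  map_zero' : toFun 0 = 0
  strictMono' : StrictMono toFun
  continuous' : Continuous toFun
  tendsto_atTop' : Filter.Tendsto toFun Filter.atTop Filter.atTop

instance : CoeFun OrliczFunction (fun _ => ℝ≥0 → ℝ≥0) := ⟨OrliczFunction.toFun⟩

/-- The three versions of the growth conditions: for all, large, or small arguments. -/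
inductive ArgRange where
  | all
  | large
  | small

/-- `φ (a u) ≥ c a ^ p φ u` for some `c > 0` and all `a ≥ 1` and all `u` in the given range. -/
def LowerGrowth (φ : OrliczFunction) (p : ℝ) : ArgRange → Prop
  | .all => ∃ c : ℝ≥0, 0 < c ∧ ∀ a u : ℝ≥0, 1 ≤ a → c * a ^ p * φ u ≤ φ (a * u)
  | .large => ∃ c : ℝ≥0, 0 < c ∧ ∃ v : ℝ≥0,
      ∀ a u : ℝ≥0, 1 ≤ a → v ≤ u → c * a ^ p * φ u ≤ φ (a * u)
  | .small => ∃ c : ℝ≥0, 0 < c ∧ ∃ v : ℝ≥0, 0 < v ∧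
      ∀ a u : ℝ≥0, 1 ≤ a → 0 < u → a * u ≤ v → c * a ^ p * φ u ≤ φ (a * u)

/-- The lower Matuszewska–Orlicz index `α_φ`, a supremum in the extended reals
(it is `+∞` when the set of exponents is unbounded). -/
noncomputable def lowerIndex (φ : OrliczFunction) (R : ArgRange) : EReal :=
  sSup ((fun p : ℝ => (p : EReal)) '' {p : ℝ | LowerGrowth φ p R})

/-- Condition `Δ^q`: `φ (a u) ≤ K a ^ q φ u` for some `K > 0` and all `a ≥ 1` and all `u` in the
given range. -/
def DeltaUpper (φ : OrliczFunction) (q : ℝ) : ArgRange → Prop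
  | .all => ∃ K : ℝ≥0, 0 < K ∧ ∀ a u : ℝ≥0, 1 ≤ a → φ (a * u) ≤ K * a ^ q * φ u
  | .large => ∃ K : ℝ≥0, 0 < K ∧ ∃ v : ℝ≥0,
      ∀ a u : ℝ≥0, 1 ≤ a → v ≤ u → φ (a * u) ≤ K * a ^ q * φ u
  | .small => ∃ K : ℝ≥0, 0 < K ∧ ∃ v : ℝ≥0, 0 < v ∧
      ∀ a u : ℝ≥0, 1 ≤ a → a * u ≤ v → φ (a * u) ≤ K * a ^ q * φ u

/-- A measure without atoms in the measure-theoretic sense: every measurable set of positive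
measure has a measurable subset of strictly smaller positive measure. (Mathlib's `NullSingletonClass` only
says that points are null.) -/
def IsNonatomic {Ω : Type*} [MeasurableSpace Ω] (μ : Measure Ω) : Prop :=
  ∀ A : Set Ω, MeasurableSet A → 0 < μ A →
    ∃ B : Set Ω, B ⊆ A ∧ MeasurableSet B ∧ 0 < μ B ∧ μ B < μ A

section OrliczSpace

variable {Ω : Type*} [MeasurableSpace Ω] {μ : Measure Ω}

/-- The modular `I_φ(f) = ∫ φ(|f|) dμ`, with values in `[0, ∞]`. -/
noncomputable def orliczModular (φ : OrliczFunction) (f : Ω →ₘ[μ] ℝ) : ℝ≥0∞ :=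
  ∫⁻ t, (φ ‖f t‖₊ : ℝ≥0∞) ∂μ

theorem orliczModular_zero (φ : OrliczFunction) : orliczModular φ (0 : Ω →ₘ[μ] ℝ) = 0 := by
  unfold orliczModular
  rw [← lintegral_zero (μ := μ)]
  apply lintegral_congr_ae
  filter_upwards [AEEqFun.coeFn_zero (α := Ω) (μ := μ) (β := ℝ)] with t ht
  simp [ht, φ.map_zero']

theorem orliczModular_le_add (φ : OrliczFunction) {f g h : Ω →ₘ[μ] ℝ}
    (hfgh : ∀ᵐ t ∂μ, ‖h t‖₊ ≤ max ‖f t‖₊ ‖g t‖₊) :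
    orliczModular φ h ≤ orliczModular φ f + orliczModular φ g := by
  unfold orliczModular
  have hm : AEMeasurable (fun t => (φ ‖f t‖₊ : ℝ≥0∞)) μ :=
    (φ.continuous'.measurable.comp f.measurable.nnnorm).coe_nnreal_ennreal.aemeasurable
  rw [← lintegral_add_left' hm]
  apply lintegral_mono_ae
  filter_upwards [hfgh] with t ht
  have h1 : φ ‖h t‖₊ ≤ φ ‖f t‖₊ + φ ‖g t‖₊ := by
    refine (φ.strictMono'.monotone ht).trans ?_
    rcases le_total ‖f t‖₊ ‖g t‖₊ with h2 | h2
    · rw [max_eq_right h2]; exact le_add_self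
    · rw [max_eq_left h2]; exact le_self_add
  exact_mod_cast h1

variable (μ) in
/-- The Orlicz space `L_φ(μ)`: the (classes of) measurable functions `f` such that
`I_φ(c f) < ∞` for some `c > 0`. -/
noncomputable def orliczSpace (φ : OrliczFunction) : Submodule ℝ (Ω →ₘ[μ] ℝ) where
  carrier := {f | ∃ c : ℝ, 0 < c ∧ orliczModular φ (c • f) < ∞}
  zero_mem' := ⟨1, one_pos, by rw [smul_zero, orliczModular_zero]; exact ENNReal.zero_lt_top⟩
  add_mem' := by
    rintro f g ⟨a, ha, hf⟩ ⟨b, hb, hg⟩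
    refine ⟨min a b / 2, by positivity, lt_of_le_of_lt ?_ (ENNReal.add_lt_top.2 ⟨hf, hg⟩)⟩
    apply orliczModular_le_add
    filter_upwards [AEEqFun.coeFn_smul (min a b / 2) (f + g), AEEqFun.coeFn_add f g,
      AEEqFun.coeFn_smul a f, AEEqFun.coeFn_smul b g] with t h1 h2 h3 h4
    rw [h1, h3, h4]
    simp only [Pi.smul_apply, h2, Pi.add_apply, smul_eq_mul]
    rw [← NNReal.coe_le_coe, NNReal.coe_max]
    simp only [coe_nnnorm, Real.norm_eq_abs, abs_mul, abs_of_pos ha, abs_of_pos hb]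
    have hm : 0 < min a b / 2 := by positivity
    rw [abs_of_pos hm]
    have h5 := abs_add_le (f t) (g t)
    have h6 : min a b * |f t| ≤ a * |f t| :=
      mul_le_mul_of_nonneg_right (min_le_left _ _) (abs_nonneg _)
    have h7 : min a b * |g t| ≤ b * |g t| :=
      mul_le_mul_of_nonneg_right (min_le_right _ _) (abs_nonneg _)
    have h8 := le_max_left (a * |f t|) (b * |g t|)
    have h9 := le_max_right (a * |f t|) (b * |g t|)
    nlinarith [mul_le_mul_of_nonneg_left h5 hm.le]
  smul_mem' := by
    rintro r f ⟨a, ha, hf⟩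
    by_cases hr : r = 0
    · refine ⟨1, one_pos, ?_⟩
      rw [hr, zero_smul, smul_zero, orliczModular_zero]
      exact ENNReal.zero_lt_top
    · have hr' : 0 < |r| := abs_pos.2 hr
      refine ⟨a / |r|, by positivity, lt_of_le_of_lt ?_ (ENNReal.add_lt_top.2 ⟨hf, hf⟩)⟩
      apply orliczModular_le_add
      rw [smul_smul]
      filter_upwards [AEEqFun.coeFn_smul (a / |r| * r) f, AEEqFun.coeFn_smul a f] with t h1 h2
      rw [h1, h2, max_self, ← NNReal.coe_le_coe]
      simp only [Pi.smul_apply, smul_eq_mul, coe_nnnorm, Real.norm_eq_abs, abs_mul, abs_div,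
        abs_abs]
      rw [div_mul_cancel₀ _ hr'.ne']

/-- The Minkowski functional `‖f‖_φ = inf {ε > 0 : I_φ(f / ε) ≤ 1}`. -/
noncomputable def orliczNorm (φ : OrliczFunction) (f : Ω →ₘ[μ] ℝ) : ℝ :=
  sInf {ε : ℝ | 0 < ε ∧ orliczModular φ (ε⁻¹ • f) ≤ 1}

end OrliczSpace

/-- The Rademacher functions `r_n(t) = sign (sin (2 ^ n π t))`, used for `n ≥ 1`. -/
noncomputable def rademacher (n : ℕ) (t : ℝ) : ℝ := Real.sign (Real.sin (2 ^ n * Real.pi * t))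

/-- Cotype `q` of the real vector space `X` with the (quasi-)norm `N`. The vectors
`x_1, …, x_n` are indexed by `Fin n`, so that `x k` is paired with `r_{k+1}`. -/
def HasCotype (X : Type*) [AddCommGroup X] [Module ℝ X] (N : X → ℝ) (q : ℝ) : Prop :=
  ∃ K : ℝ, 0 < K ∧ ∀ (n : ℕ) (x : Fin n → X),
    (∑ k, N (x k) ^ q) ^ (1 / q) ≤
      K * ∫ t in (0 : ℝ)..1, N (∑ k : Fin n, rademacher ((k : ℕ) + 1) t • x k)

/-- The Orlicz space `L_φ(μ)` with its Minkowski functional has cotype `q`. -/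
def OrliczHasCotype {Ω : Type*} [MeasurableSpace Ω] (μ : Measure Ω) (φ : OrliczFunction)
    (q : ℝ) : Prop :=
  HasCotype (orliczSpace μ φ) (fun f => orliczNorm φ (f : Ω →ₘ[μ] ℝ)) q

/-! ### The modular and its Minkowski functional without convexity. -/

section OrliczBasics

variable {Ω : Type*} [MeasurableSpace Ω] {μ : Measure Ω} {φ : OrliczFunction}

/-! Without convexity the functional need not satisfy the triangle inequality, so both directions
work with the modular and monotonicity of `φ`.

Sufficiency. By `integral_comp_rademacher` the Rademacher integral is an average over sign vectors;
let `M` exceed it. Markov's inequality makes most signed sums have norm below `25 * M`, and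
Paley–Zygmund makes a fixed proportion of them dominate the square function at each point. Averaging
gives a modular bound by 24 for a multiple of the square function (`lintegral_squareFunction_le`).
Positivity of the index is used only to shrink 24 to 1/4 by dividing by a large `a`; the result, cut
off below at `v`, is a function `s` of modular at most 1/2. Now `Δ^q` is applied pointwise with base
point `s`: where `|x| / l` exceeds `s`, `φ (|x| / l)` is at most a constant times `(|x| / (l s)) ^ q
* φ s`. This bounds `‖x‖ ^ q` by a weighted integral of `|x| ^ q` (`orliczNorm_rpow_le`). Summing
over `k` and using `q ≥ 2`, the sum of `q`-th powers of the ratios is at most the sum of their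
squares, hence at most 1 (`sum_orliczNorm_rpow_le`).

Necessity. Cotype is tested on indicators of `n` disjoint sets of measure `1 / φ w` with `φ w` equal
or close to `n * φ u`. Each has norm at least `1 / w`, every signed sum has norm at most `1 / u`, so
`n ^ (1 / q) * u ≤ K * w`. Taking `n` of order `a ^ q` gives `a * u ≤ w`, and then `φ (a * u) ≤ φ w`
is the growth bound. Such sets come from Sierpiński's theorem, or from blocks of integers. -/

theorem OrliczFunction.monotone (φ : OrliczFunction) : Monotone φ := φ.strictMono'.monotone

theorem OrliczFunction.pos (φ : OrliczFunction) {u : ℝ≥0} (hu : 0 < u) : 0 < φ u := by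
  simpa [φ.map_zero'] using φ.strictMono' hu

theorem OrliczFunction.surjective (φ : OrliczFunction) : Function.Surjective φ := by
  intro y
  obtain ⟨b, hb⟩ := (φ.tendsto_atTop'.eventually_ge_atTop y).exists
  obtain ⟨x, -, hx⟩ := intermediate_value_Icc (zero_le (a := b)) φ.continuous'.continuousOn
    (show y ∈ Set.Icc (φ 0) (φ b) from ⟨by simp [φ.map_zero'], hb⟩)
  exact ⟨x, hx⟩

theorem OrliczFunction.exists_pos_eq (φ : OrliczFunction) {y : ℝ≥0} (hy : 0 < y) :
    ∃ v, 0 < v ∧ φ v = y := by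
  obtain ⟨v, rfl⟩ := φ.surjective y
  refine ⟨v, ?_, rfl⟩
  rcases (zero_le (a := v)).eq_or_lt with h0 | h0
  · rw [← h0, φ.map_zero'] at hy
    exact absurd hy (lt_irrefl _)
  · exact h0

theorem OrliczFunction.measurable (φ : OrliczFunction) : Measurable φ := φ.continuous'.measurable

theorem orliczModular_smul (c : ℝ) (f : Ω →ₘ[μ] ℝ) :
    orliczModular φ (c • f) = ∫⁻ t, (φ (‖c‖₊ * ‖f t‖₊) : ℝ≥0∞) ∂μ := by
  unfold orliczModular
  apply lintegral_congr_ae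
  filter_upwards [AEEqFun.coeFn_smul c f] with t ht
  rw [ht, Pi.smul_apply, smul_eq_mul, nnnorm_mul]

theorem orliczModular_smul_mono {c d : ℝ} (h : ‖c‖₊ ≤ ‖d‖₊) (f : Ω →ₘ[μ] ℝ) :
    orliczModular φ (c • f) ≤ orliczModular φ (d • f) := by
  rw [orliczModular_smul, orliczModular_smul]
  refine lintegral_mono fun t => ?_
  exact ENNReal.coe_le_coe.2 (φ.monotone (mul_le_mul_left h _))

/-- Dominated convergence replaces convexity: `φ` is continuous and vanishes at 0, so the modular
tends to 0 under shrinking. The infimum defining the norm is thus over a nonempty set. -/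
theorem exists_orliczModular_inv_smul_le_one {f : Ω →ₘ[μ] ℝ} (hf : f ∈ orliczSpace μ φ) :
    ∃ ε : ℝ, 0 < ε ∧ orliczModular φ (ε⁻¹ • f) ≤ 1 := by
  obtain ⟨c, hc, hfin⟩ := hf
  rw [orliczModular_smul] at hfin
  have key : Filter.Tendsto
      (fun n : ℕ => ∫⁻ t, (φ (‖((n : ℝ) + 1)⁻¹ * c‖₊ * ‖f t‖₊) : ℝ≥0∞) ∂μ)
      Filter.atTop (nhds (∫⁻ _, 0 ∂μ)) := by
    refine tendsto_lintegral_of_dominated_convergence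
      (fun t => (φ (‖c‖₊ * ‖f t‖₊) : ℝ≥0∞)) (fun n => ?_) (fun n => ?_) hfin.ne ?_
    · exact (φ.measurable.comp (f.measurable.nnnorm.const_mul _)).coe_nnreal_ennreal
    · refine Filter.Eventually.of_forall fun t => ?_
      have : ‖((n : ℝ) + 1)⁻¹ * c‖₊ ≤ ‖c‖₊ := by
        rw [← NNReal.coe_le_coe]
        simp only [coe_nnnorm, norm_mul, norm_inv]
        refine mul_le_of_le_one_left (norm_nonneg _) (inv_le_one_of_one_le₀ ?_)
        rw [Real.norm_of_nonneg (by positivity)]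
        linarith [(Nat.cast_nonneg n : (0 : ℝ) ≤ n)]
      exact ENNReal.coe_le_coe.2 (φ.monotone (mul_le_mul_left this _))
    · refine Filter.Eventually.of_forall fun t => ?_
      have h1 : Filter.Tendsto (fun n : ℕ => ‖((n : ℝ) + 1)⁻¹ * c‖₊ * ‖f t‖₊)
          Filter.atTop (nhds (‖(0 : ℝ) * c‖₊ * ‖f t‖₊)) := by
        refine Filter.Tendsto.mul_const _ (Filter.Tendsto.nnnorm (Filter.Tendsto.mul_const _ ?_))
        simpa using tendsto_one_div_add_atTop_nhds_zero_nat (𝕜 := ℝ)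
      have h2 := (φ.continuous'.tendsto _).comp h1
      simp only [zero_mul, nnnorm_zero, φ.map_zero'] at h2
      exact ENNReal.tendsto_coe.2 h2
  rw [lintegral_zero] at key
  obtain ⟨n, hn⟩ := (key.eventually_le_const (show (0 : ℝ≥0∞) < 1 by simp)).exists
  refine ⟨((n : ℝ) + 1) * c⁻¹, by positivity, ?_⟩
  rw [orliczModular_smul]
  simpa [mul_comm] using hn

theorem orliczNorm_nonneg (f : Ω →ₘ[μ] ℝ) : 0 ≤ orliczNorm φ f :=
  Real.sInf_nonneg fun _ h => h.1.le

theorem orliczNorm_le {f : Ω →ₘ[μ] ℝ} {r : ℝ} (hr : 0 < r) (h : orliczModular φ (r⁻¹ • f) ≤ 1) :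
    orliczNorm φ f ≤ r :=
  csInf_le ⟨0, fun _ h => h.1.le⟩ ⟨hr, h⟩

theorem one_lt_orliczModular {f : Ω →ₘ[μ] ℝ} {r : ℝ} (hr : 0 < r) (h : r < orliczNorm φ f) :
    1 < orliczModular φ (r⁻¹ • f) :=
  not_le.1 fun h' => (orliczNorm_le hr h').not_gt h

theorem orliczModular_le_one {f : Ω →ₘ[μ] ℝ} (hf : f ∈ orliczSpace μ φ) {r : ℝ}
    (h : orliczNorm φ f < r) : orliczModular φ (r⁻¹ • f) ≤ 1 := by
  obtain ⟨ε, ⟨hε, hle⟩, hlt⟩ := exists_lt_of_csInf_lt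
    (exists_orliczModular_inv_smul_le_one hf) h
  refine (orliczModular_smul_mono ?_ f).trans hle
  rw [← NNReal.coe_le_coe, coe_nnnorm, coe_nnnorm, norm_inv, norm_inv,
    Real.norm_of_nonneg hε.le, Real.norm_of_nonneg (hε.trans hlt).le]
  exact inv_anti₀ hε hlt.le

theorem coeFn_sum_smul {ι : Type*} (s : Finset ι) (c : ι → ℝ) (x : ι → Ω →ₘ[μ] ℝ) :
    ⇑(∑ k ∈ s, c k • x k) =ᵐ[μ] fun t => ∑ k ∈ s, c k * x k t := by
  classical
  induction s using Finset.induction_on with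
  | empty =>
    simp only [Finset.sum_empty]
    exact AEEqFun.coeFn_zero
  | insert a s ha ih =>
    rw [Finset.sum_insert ha]
    filter_upwards [ih, AEEqFun.coeFn_add (c a • x a) (∑ k ∈ s, c k • x k),
      AEEqFun.coeFn_smul (c a) (x a)] with t h1 h2 h3
    rw [h2, Pi.add_apply, h1, h3, Finset.sum_insert ha, Pi.smul_apply, smul_eq_mul]

end OrliczBasics

/-! ### Rademacher averages and moments of sign sums. -/

section Rademacher

/-- The sign `±1` attached to a Boolean. -/
def boolSign (b : Bool) : ℝ := if b then 1 else -1

theorem sum_boolFun_succ {n : ℕ} (F : (Fin (n + 1) → ℝ) → ℝ) :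
    ∑ σ : Fin (n + 1) → Bool, F (fun k => boolSign (σ k)) =
      ∑ σ : Fin n → Bool, F (Fin.cons 1 fun k => boolSign (σ k)) +
        ∑ σ : Fin n → Bool, F (Fin.cons (-1) fun k => boolSign (σ k)) := by
  rw [← (Fin.consEquiv fun _ : Fin (n + 1) => Bool).sum_comp, Fintype.sum_prod_type,
    Fintype.sum_bool]
  congr 1 <;>
  · refine Finset.sum_congr rfl fun σ _ => congrArg F (funext fun k => ?_)
    refine Fin.cases ?_ (fun j => ?_) k <;> simp [Fin.consEquiv, boolSign]

theorem rademacher_one_of_lt_half {t : ℝ} (h0 : 0 < t) (h1 : t < 1 / 2) : rademacher 1 t = 1 := by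
  unfold rademacher
  refine Real.sign_of_pos (Real.sin_pos_of_pos_of_lt_pi (by positivity) ?_)
  nlinarith [Real.pi_pos]

theorem rademacher_one_of_half_lt {t : ℝ} (h0 : 1 / 2 < t) (h1 : t < 1) : rademacher 1 t = -1 := by
  unfold rademacher
  refine Real.sign_of_neg ?_
  rw [← Real.sin_sub_two_pi]
  refine Real.sin_neg_of_neg_of_neg_pi_lt ?_ ?_ <;> nlinarith [Real.pi_pos]

theorem rademacher_succ (k : ℕ) (t : ℝ) : rademacher (k + 1) t = rademacher k (2 * t) := by
  unfold rademacher
  congr 2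
  ring

theorem rademacher_sub_one (k : ℕ) (t : ℝ) : rademacher (k + 1) (t - 1) = rademacher (k + 1) t := by
  unfold rademacher
  congr 1
  have : (2 : ℝ) ^ (k + 1) * Real.pi * (t - 1) =
      2 ^ (k + 1) * Real.pi * t - (2 ^ k : ℕ) * (2 * Real.pi) := by push_cast; ring
  rw [this, Real.sin_sub_nat_mul_two_pi]

theorem abs_rademacher_le_one (k : ℕ) (t : ℝ) : |rademacher k t| ≤ 1 := by
  unfold rademacher
  rcases Real.sign_apply_eq (Real.sin (2 ^ k * Real.pi * t)) with h | h | h <;> simp [h]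

/-- The vector `(r_1, …, r_n)` is uniformly distributed on `{1, -1}^n`. -/
theorem integral_comp_rademacher : ∀ (n : ℕ) (F : (Fin n → ℝ) → ℝ),
    IntervalIntegrable (fun t => F fun k => rademacher ((k : ℕ) + 1) t) volume 0 1 ∧
    ∫ t in (0 : ℝ)..1, F (fun k => rademacher ((k : ℕ) + 1) t) =
      (2 ^ n)⁻¹ * ∑ σ : Fin n → Bool, F (fun k => boolSign (σ k)) := by
  intro n
  induction n with
  | zero =>
    intro F
    have h : ∀ g : Fin 0 → ℝ, F g = F ![] := fun g => congrArg F (Subsingleton.elim _ _)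
    simp [h]
  | succ n ih =>
    intro F
    -- The first function is constant on each open half of the interval; the remaining ones are the
    -- earlier functions at `2 * t`, or at `2 * t - 1` by periodicity.
    set R : ℝ → Fin n → ℝ := fun t k => rademacher ((k : ℕ) + 1) t with hR
    obtain ⟨i1, e1⟩ := ih fun g => F (Fin.cons 1 g)
    obtain ⟨i2, e2⟩ := ih fun g => F (Fin.cons (-1) g)
    have c1 : ∀ t ∈ Set.Ioo (0 : ℝ) (1 / 2), F (Fin.cons 1 (R (2 * t))) =
        F (fun k => rademacher ((k : ℕ) + 1) t) := by
      intro t ht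
      refine congrArg F (funext fun k => ?_)
      refine Fin.cases ?_ (fun j => ?_) k
      · simp [rademacher_one_of_lt_half ht.1 ht.2]
      · simp [hR, rademacher_succ]
    have c2 : ∀ t ∈ Set.Ioo (1 / 2 : ℝ) 1, F (Fin.cons (-1) (R (2 * t - 1))) =
        F (fun k => rademacher ((k : ℕ) + 1) t) := by
      intro t ht
      refine congrArg F (funext fun k => ?_)
      refine Fin.cases ?_ (fun j => ?_) k
      · simp [rademacher_one_of_half_lt ht.1 ht.2]
      · simp only [hR, Fin.cons_succ, rademacher_sub_one, Fin.val_succ]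
        rw [rademacher_succ ((j : ℕ) + 1) t]
    have j1 : IntervalIntegrable (fun t => F (Fin.cons 1 (R (2 * t)))) volume 0 (1 / 2) := by
      simpa using i1.comp_mul_left (c := 2)
    have j2 : IntervalIntegrable (fun t => F (Fin.cons (-1) (R (2 * t - 1)))) volume (1 / 2) 1 := by
      have h := (i2.comp_sub_right 1).comp_mul_left (c := 2)
      norm_num at h
      exact h
    have k1 := (intervalIntegrable_congr_uIoo (f := fun t => F (Fin.cons 1 (R (2 * t))))
      (g := fun t => F (fun k => rademacher ((k : ℕ) + 1) t)) (μ := volume) (a := 0) (b := 1 / 2)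
      (by rw [Set.uIoo_of_le (by norm_num)]; exact c1)).1 j1
    have k2 := (intervalIntegrable_congr_uIoo
      (f := fun t => F (Fin.cons (-1) (R (2 * t - 1))))
      (g := fun t => F (fun k => rademacher ((k : ℕ) + 1) t)) (μ := volume) (a := 1 / 2) (b := 1)
      (by rw [Set.uIoo_of_le (by norm_num)]; exact c2)).1 j2
    refine ⟨k1.trans k2, ?_⟩
    rw [← intervalIntegral.integral_add_adjacent_intervals k1 k2,
      ← intervalIntegral.integral_congr_Ioo_of_le (by norm_num) c1,
      ← intervalIntegral.integral_congr_Ioo_of_le (by norm_num) c2,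
      intervalIntegral.integral_comp_mul_left (fun t => F (Fin.cons 1 (R t))) two_ne_zero,
      intervalIntegral.integral_comp_mul_sub (fun t => F (Fin.cons (-1) (R t))) two_ne_zero,
      sum_boolFun_succ]
    norm_num
    rw [e1, e2, pow_succ]
    ring

theorem sum_sq_boolSign {n : ℕ} (a : Fin n → ℝ) :
    ∑ σ : Fin n → Bool, (∑ k, boolSign (σ k) * a k) ^ 2 = 2 ^ n * ∑ k, a k ^ 2 := by
  induction n with
  | zero => simp
  | succ n ih =>
    rw [sum_boolFun_succ (fun g => (∑ k, g k * a k) ^ 2), ← Finset.sum_add_distrib]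
    have h := ih fun k => a k.succ
    simp only [Fin.sum_univ_succ, Fin.cons_zero, Fin.cons_succ]
    calc _ = ∑ σ : Fin n → Bool, (2 * (∑ k, boolSign (σ k) * a k.succ) ^ 2 + 2 * a 0 ^ 2) :=
          Finset.sum_congr rfl fun σ _ => by ring
      _ = _ := by
          rw [Finset.sum_add_distrib, ← Finset.mul_sum, h]
          simp
          ring

/-- Averaging over one sign kills the odd terms of the binomial expansion, and the mixed term is
given exactly by the second moment. -/
theorem sum_fourth_boolSign {n : ℕ} (a : Fin n → ℝ) :
    ∑ σ : Fin n → Bool, (∑ k, boolSign (σ k) * a k) ^ 4 ≤ 3 * 2 ^ n * (∑ k, a k ^ 2) ^ 2 := by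
  induction n with
  | zero => simp
  | succ n ih =>
    rw [sum_boolFun_succ (fun g => (∑ k, g k * a k) ^ 4), ← Finset.sum_add_distrib]
    have h := ih fun k => a k.succ
    have h2 := sum_sq_boolSign fun k => a k.succ
    simp only [Fin.sum_univ_succ, Fin.cons_zero, Fin.cons_succ]
    calc _ = ∑ σ : Fin n → Bool, (2 * (∑ k, boolSign (σ k) * a k.succ) ^ 4 +
            12 * a 0 ^ 2 * (∑ k, boolSign (σ k) * a k.succ) ^ 2 + 2 * a 0 ^ 4) :=
          Finset.sum_congr rfl fun σ _ => by ring
      _ ≤ _ := by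
          rw [Finset.sum_add_distrib, Finset.sum_add_distrib, ← Finset.mul_sum, ← Finset.mul_sum,
            h2]
          simp
          have : 0 ≤ (2 : ℝ) ^ n * a 0 ^ 4 := by positivity
          rw [pow_succ 2 n]
          nlinarith

/-- A Paley–Zygmund inequality for Rademacher sums. -/
theorem two_pow_le_card_half_le_sq {n : ℕ} (a : Fin n → ℝ) :
    2 ^ n ≤ 12 * (Finset.univ.filter fun σ : Fin n → Bool =>
      (∑ k, a k ^ 2) / 2 ≤ (∑ k, boolSign (σ k) * a k) ^ 2).card := by
  set s := ∑ k, a k ^ 2 with hs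
  have hs0 : 0 ≤ s := Finset.sum_nonneg fun _ _ => sq_nonneg _
  rcases hs0.eq_or_lt with h0 | hpos
  · rw [Finset.filter_true_of_mem fun σ _ => by rw [← h0]; simp; positivity]
    simp
  -- On the large set this is `(T ^ 2 - 6 * s) ^ 2 ≥ 0`. After averaging, the second and fourth
  -- moments give `s ^ 2 ≤ s ^ 2 / 2 + s ^ 2 / 4 + 3 * s ^ 2 * P`, so the proportion `P` is at least
  -- 1/12.
  · have key : ∀ σ : Fin n → Bool, (∑ k, boolSign (σ k) * a k) ^ 2 * s ≤
        s ^ 2 / 2 + (∑ k, boolSign (σ k) * a k) ^ 4 / 12 +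
          3 * s ^ 2 * (if s / 2 ≤ (∑ k, boolSign (σ k) * a k) ^ 2 then 1 else 0) := by
      intro σ
      set T := ∑ k, boolSign (σ k) * a k
      split_ifs with h
      · nlinarith [sq_nonneg (T ^ 2 - 6 * s)]
      · nlinarith [sq_nonneg (T ^ 2)]
    have h1 := Finset.sum_le_sum fun σ (_ : σ ∈ Finset.univ) => key σ
    rw [← Finset.sum_mul, Finset.sum_add_distrib, Finset.sum_add_distrib, ← Finset.mul_sum,
      ← Finset.sum_div, ← Finset.sum_div, sum_sq_boolSign, Finset.sum_boole] at h1
    have h2 := sum_fourth_boolSign a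
    rw [← hs] at h1 h2
    simp at h1
    have h3 : (2 ^ n : ℝ) ≤ 12 * ((Finset.univ.filter fun σ : Fin n → Bool =>
      s / 2 ≤ (∑ k, boolSign (σ k) * a k) ^ 2).card : ℝ) := by
      have : 0 < s ^ 2 := by positivity
      by_contra! hcon
      nlinarith
    exact_mod_cast h3

end Rademacher

/-! ### From growth conditions to cotype. -/

section Sufficiency

variable {Ω : Type*} [MeasurableSpace Ω] {μ : Measure Ω} {φ : OrliczFunction}

/-- A modular square function estimate: the signs `σ` are averaged over `{1, -1}^n`. -/
theorem lintegral_squareFunction_le {n : ℕ} (x : Fin n → Ω →ₘ[μ] ℝ)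
    (hx : ∀ k, x k ∈ orliczSpace μ φ) {M : ℝ} (hM : 0 < M)
    (h : ∑ σ : Fin n → Bool, orliczNorm φ (∑ k, boolSign (σ k) • x k) ≤ 2 ^ n * M) :
    ∫⁻ t, (φ (Real.toNNReal (√((∑ k, x k t ^ 2) / 2) / (25 * M))) : ℝ≥0∞) ∂μ ≤ 24 := by
  classical
  set S : (Fin n → Bool) → Ω →ₘ[μ] ℝ := fun σ => ∑ k, boolSign (σ k) • x k with hS
  have hmem : ∀ σ, S σ ∈ orliczSpace μ φ := fun σ =>
    Submodule.sum_mem _ fun k _ => Submodule.smul_mem _ _ (hx k)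
  -- Markov leaves at most 1/25 of the signs outside `A`. Against the Paley–Zygmund proportion 1/12,
  -- at least 1/12 - 1/24 = 1/24 remain at each point.
  set A := Finset.univ.filter fun σ => orliczNorm φ (S σ) < 25 * M with hA
  have hAc : 24 * Aᶜ.card ≤ 2 ^ n := by
    have h1 : Aᶜ.card • (25 * M) ≤ ∑ σ ∈ Aᶜ, orliczNorm φ (S σ) :=
      Finset.card_nsmul_le_sum _ _ _ fun σ hσ => by simpa [hA] using hσ
    have h2 : ∑ σ ∈ Aᶜ, orliczNorm φ (S σ) ≤ ∑ σ, orliczNorm φ (S σ) :=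
      Finset.sum_le_sum_of_subset_of_nonneg (Finset.subset_univ _) fun _ _ _ => orliczNorm_nonneg _
    have h3 := h1.trans (h2.trans h)
    rw [nsmul_eq_mul] at h3
    have h4 : (25 * Aᶜ.card : ℝ) ≤ 2 ^ n := by
      by_contra! hc
      nlinarith
    have h5 : 25 * Aᶜ.card ≤ 2 ^ n := by exact_mod_cast h4
    omega
  have hpt : ∀ᵐ t ∂μ, (2 : ℝ≥0∞) ^ n *
      (φ (Real.toNNReal (√((∑ k, x k t ^ 2) / 2) / (25 * M))) : ℝ≥0∞) ≤
      24 * ∑ σ ∈ A, (φ (‖(25 * M)⁻¹‖₊ * ‖S σ t‖₊) : ℝ≥0∞) := by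
    have hco : ∀ᵐ t ∂μ, ∀ σ, S σ t = ∑ k, boolSign (σ k) * x k t :=
      ae_all_iff.2 fun σ => coeFn_sum_smul _ _ _
    filter_upwards [hco] with t ht
    set g := Real.toNNReal (√((∑ k, x k t ^ 2) / 2) / (25 * M))
    set G := Finset.univ.filter fun σ : Fin n → Bool =>
      (∑ k, x k t ^ 2) / 2 ≤ (∑ k, boolSign (σ k) * x k t) ^ 2
    have hG : 2 ^ n ≤ 12 * G.card := two_pow_le_card_half_le_sq fun k => x k t
    have hGA : 2 ^ n ≤ 24 * (G ∩ A).card := by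
      have h1 : G.card ≤ (G ∩ A).card + Aᶜ.card := by
        refine (Finset.card_le_card fun σ hσ => ?_).trans (Finset.card_union_le _ _)
        by_cases hσA : σ ∈ A <;> simp [hσ, hσA]
      omega
    have hle : ∀ σ ∈ G ∩ A, (φ g : ℝ≥0∞) ≤ φ (‖(25 * M)⁻¹‖₊ * ‖S σ t‖₊) := by
      intro σ hσ
      refine ENNReal.coe_le_coe.2 (φ.monotone ?_)
      have h1 : (∑ k, x k t ^ 2) / 2 ≤ (∑ k, boolSign (σ k) * x k t) ^ 2 := by
        have := (Finset.mem_inter.1 hσ).1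
        simpa [G] using this
      rw [← ht σ] at h1
      have h2 := Real.sqrt_le_sqrt h1
      rw [Real.sqrt_sq_eq_abs] at h2
      refine Real.toNNReal_le_iff_le_coe.2 ?_
      simp only [NNReal.coe_mul, coe_nnnorm, Real.norm_eq_abs]
      rw [abs_of_pos (by positivity), div_eq_inv_mul]
      gcongr
    calc (2 : ℝ≥0∞) ^ n * (φ g : ℝ≥0∞) ≤ (24 * (G ∩ A).card) * (φ g : ℝ≥0∞) := by
          gcongr
          exact_mod_cast hGA
      _ = 24 * ((G ∩ A).card • (φ g : ℝ≥0∞)) := by rw [nsmul_eq_mul, mul_assoc]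
      _ ≤ 24 * ∑ σ ∈ G ∩ A, (φ (‖(25 * M)⁻¹‖₊ * ‖S σ t‖₊) : ℝ≥0∞) := by
          gcongr
          exact Finset.card_nsmul_le_sum _ _ _ hle
      _ ≤ _ := by
          gcongr
          exact Finset.inter_subset_right
  have hint := lintegral_mono_ae hpt
  have hm : ∀ σ, Measurable fun t => (φ (‖(25 * M)⁻¹‖₊ * ‖S σ t‖₊) : ℝ≥0∞) := fun σ =>
    (φ.measurable.comp ((S σ).measurable.nnnorm.const_mul _)).coe_nnreal_ennreal
  rw [lintegral_const_mul' _ _ (by simp), lintegral_const_mul _ (by fun_prop),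
    lintegral_finsetSum _ fun σ _ => hm σ] at hint
  have hone : ∀ σ ∈ A, ∫⁻ t, (φ (‖(25 * M)⁻¹‖₊ * ‖S σ t‖₊) : ℝ≥0∞) ∂μ ≤ 1 := by
    intro σ hσ
    rw [← orliczModular_smul]
    exact orliczModular_le_one (hmem σ) (by simpa [hA] using hσ)
  have hcard : ∑ σ ∈ A, ∫⁻ t, (φ (‖(25 * M)⁻¹‖₊ * ‖S σ t‖₊) : ℝ≥0∞) ∂μ ≤ 2 ^ n := by
    refine (Finset.sum_le_card_nsmul _ _ _ hone).trans ?_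
    have : A.card ≤ 2 ^ n := (Finset.card_le_univ A).trans (by simp)
    simpa using (by exact_mod_cast this : (A.card : ℝ≥0∞) ≤ 2 ^ n)
  have h2 : (2 : ℝ≥0∞) ^ n ≠ 0 := by simp
  have h3 : (2 : ℝ≥0∞) ^ n ≠ ∞ := by simp
  rw [← ENNReal.mul_le_mul_iff_right h2 h3, mul_comm _ 24]
  exact hint.trans (by gcongr)

variable {q : ℝ} {v K : ℝ≥0} {V : ℝ≥0∞}

/-- At half the norm the modular exceeds 1, while `s` accounts for at most 1/2 of it. The rest comes
from points where `|x| / l > s`, and there the growth bound extracts `l ^ (-q)`. The bound `V`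
covers all three ranges: infinite, or a cap on the arguments in the discrete case. -/
theorem orliczNorm_rpow_le (hq : 0 < q)
    (hup : ∀ a u : ℝ≥0, 1 ≤ a → v ≤ u → ((a * u : ℝ≥0) : ℝ≥0∞) ≤ V → φ (a * u) ≤ K * a ^ q * φ u)
    (hV : ∀ g : Ω → ℝ≥0, Measurable g → ∫⁻ t, (φ (g t) : ℝ≥0∞) ∂μ ≤ 24 →
      ∀ᵐ t ∂μ, ((4 * g t : ℝ≥0) : ℝ≥0∞) ≤ V)
    {x : Ω →ₘ[μ] ℝ} (hx : x ∈ orliczSpace μ φ) {s : Ω → ℝ≥0} (hs : Measurable s)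
    (hvs : ∀ t, v ≤ s t) (hφs : ∫⁻ t, (φ (s t) : ℝ≥0∞) ∂μ ≤ 1 / 2) {τ : ℝ≥0} (hτ : 0 < τ)
    (hxs : ∀ t, τ * ‖x t‖₊ ≤ s t) :
    ENNReal.ofReal (orliczNorm φ x ^ q) ≤ ((2 * (K * (2 / τ) ^ q) : ℝ≥0) : ℝ≥0∞) *
      ∫⁻ t, (((τ * ‖x t‖₊ / s t) ^ q * φ (s t) : ℝ≥0) : ℝ≥0∞) ∂μ := by
  rcases (orliczNorm_nonneg (φ := φ) x).eq_or_lt with h0 | hpos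
  · rw [← h0, Real.zero_rpow hq.ne']
    simp
  obtain ⟨l, hl⟩ : ∃ l : ℝ≥0, orliczNorm φ x = 2 * l :=
    ⟨Real.toNNReal (orliczNorm φ x / 2), by
      rw [Real.coe_toNNReal _ (by positivity)]; ring⟩
  have hl0 : 0 < l := by
    rw [hl] at hpos
    exact_mod_cast (by linarith : (0 : ℝ) < l)
  have hl0' : (0 : ℝ) < l := hl0
  have h1 : 1 < orliczModular φ ((l : ℝ)⁻¹ • x) := one_lt_orliczModular hl0' (by linarith)
  -- Since `4 * l` is above the norm `2 * l`, `hV` applies to `|x| / (4 * l)`; its factor 4 then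
  -- bounds `|x| / l` by `V`.
  have h2 : orliczModular φ ((4 * l : ℝ)⁻¹ • x) ≤ 1 := orliczModular_le_one hx (by linarith)
  rw [orliczModular_smul] at h1 h2
  have hbV := hV (fun t => ‖(4 * l : ℝ)⁻¹‖₊ * ‖x t‖₊) (x.measurable.nnnorm.const_mul _)
    (h2.trans (by norm_num))
  set J := ∫⁻ t, (((τ * ‖x t‖₊ / s t) ^ q * φ (s t) : ℝ≥0) : ℝ≥0∞) ∂μ with hJ
  have hpt : ∀ᵐ t ∂μ, (φ (‖(l : ℝ)⁻¹‖₊ * ‖x t‖₊) : ℝ≥0∞) ≤ φ (s t) +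
      ((K * ((l * τ)⁻¹) ^ q : ℝ≥0) : ℝ≥0∞) *
        (((τ * ‖x t‖₊ / s t) ^ q * φ (s t) : ℝ≥0) : ℝ≥0∞) := by
    filter_upwards [hbV] with t ht
    rw [← ENNReal.coe_mul, ← ENNReal.coe_add]
    refine ENNReal.coe_le_coe.2 ?_
    have e1 : ‖(l : ℝ)⁻¹‖₊ = l⁻¹ := by
      rw [nnnorm_inv]; simp
    have e2 : 4 * (‖(4 * l : ℝ)⁻¹‖₊ * ‖x t‖₊) = l⁻¹ * ‖x t‖₊ := by
      have : ‖(4 * l : ℝ)⁻¹‖₊ = 4⁻¹ * l⁻¹ := by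
        rw [nnnorm_inv, nnnorm_mul]
        simp [mul_comm]
      rw [this, ← mul_assoc, ← mul_assoc, mul_inv_cancel₀ (by norm_num), one_mul]
    rw [e2] at ht
    rw [e1]
    rcases le_or_gt (l⁻¹ * ‖x t‖₊) (s t) with hle | hgt
    · exact (φ.monotone hle).trans le_self_add
    · have hs0 : 0 < s t := by
        rcases (zero_le (a := s t)).eq_or_lt with h | h
        · have := hxs t
          rw [← h, nonpos_iff_eq_zero, mul_eq_zero] at this
          rw [← h, this.resolve_left hτ.ne'] at hgt
          simp at hgt
        · exact h
      have e3 : l⁻¹ * ‖x t‖₊ / s t * s t = l⁻¹ * ‖x t‖₊ := div_mul_cancel₀ _ hs0.ne'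
      have h4 := hup (l⁻¹ * ‖x t‖₊ / s t) (s t) ((one_le_div hs0).2 hgt.le) (hvs t)
        (by rwa [e3])
      rw [e3] at h4
      refine h4.trans (le_trans (le_of_eq ?_) le_add_self)
      have e4 : l⁻¹ * ‖x t‖₊ / s t = (l * τ)⁻¹ * (τ * ‖x t‖₊ / s t) := by
        field_simp
      rw [e4, NNReal.mul_rpow]
      ring
  have hint := h1.le.trans (lintegral_mono_ae hpt)
  have hms : Measurable fun t => (φ (s t) : ℝ≥0∞) := (φ.measurable.comp hs).coe_nnreal_ennreal
  rw [lintegral_add_left hms,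
    lintegral_const_mul' _ _ ENNReal.coe_ne_top, ← hJ] at hint
  set D : ℝ≥0 := K * ((l * τ)⁻¹) ^ q with hD
  have h5 : (1 : ℝ≥0∞) ≤ 2 * (D * J) := by
    have h6 : (1 / 2 : ℝ≥0∞) + 1 / 2 ≤ 1 / 2 + D * J := by
      rw [ENNReal.add_halves]
      exact hint.trans (by gcongr)
    have h7 : (1 / 2 : ℝ≥0∞) ≤ D * J := (ENNReal.add_le_add_iff_left (by simp)).1 h6
    calc (1 : ℝ≥0∞) = 2 * (1 / 2) := by
          rw [one_div, ENNReal.mul_inv_cancel (by simp) (by simp)]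
      _ ≤ _ := by gcongr
  have e5 : ENNReal.ofReal (orliczNorm φ x ^ q) = (((2 * l) ^ q : ℝ≥0) : ℝ≥0∞) := by
    rw [hl, ← ENNReal.ofReal_coe_nnreal]
    push_cast
    rfl
  have e6 : (2 * l) ^ q * (2 * D) = 2 * (K * (2 / τ) ^ q) := by
    have : 2 / τ = (2 * l) * (l * τ)⁻¹ := by field_simp
    rw [hD, this, NNReal.mul_rpow (x := 2 * l)]
    ring
  rw [e5, ← e6]
  calc (((2 * l) ^ q : ℝ≥0) : ℝ≥0∞) = (((2 * l) ^ q : ℝ≥0) : ℝ≥0∞) * 1 := (mul_one _).symm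
    _ ≤ (((2 * l) ^ q : ℝ≥0) : ℝ≥0∞) * (2 * (D * J)) := by gcongr
    _ = _ := by
      rw [ENNReal.coe_mul ((2 * l) ^ q), ENNReal.coe_mul 2 D]
      push_cast
      ring

theorem sum_orliczNorm_rpow_le (hq : 2 ≤ q)
    (hup : ∀ a u : ℝ≥0, 1 ≤ a → v ≤ u → ((a * u : ℝ≥0) : ℝ≥0∞) ≤ V → φ (a * u) ≤ K * a ^ q * φ u)
    (hV : ∀ g : Ω → ℝ≥0, Measurable g → ∫⁻ t, (φ (g t) : ℝ≥0∞) ∂μ ≤ 24 →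
      ∀ᵐ t ∂μ, ((4 * g t : ℝ≥0) : ℝ≥0∞) ≤ V)
    {n : ℕ} {x : Fin n → Ω →ₘ[μ] ℝ} (hx : ∀ k, x k ∈ orliczSpace μ φ) {s : Ω → ℝ≥0}
    (hs : Measurable s) (hvs : ∀ t, v ≤ s t) (hφs : ∫⁻ t, (φ (s t) : ℝ≥0∞) ∂μ ≤ 1 / 2)
    {τ : ℝ≥0} (hτ : 0 < τ) (hxs : ∀ t, ∑ k, (τ * ‖x k t‖₊) ^ 2 ≤ s t ^ 2) :
    ∑ k, orliczNorm φ (x k) ^ q ≤ K * (2 / τ) ^ q := by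
  have hxs1 : ∀ k t, τ * ‖x k t‖₊ ≤ s t := fun k t =>
    (pow_le_pow_iff_left₀ zero_le zero_le two_ne_zero).1 ((Finset.single_le_sum (f := fun k => (τ * ‖x k t‖₊) ^ 2)
      (fun _ _ => zero_le) (Finset.mem_univ k)).trans (hxs t))
  have hpt : ∀ t, ∑ k, ((τ * ‖x k t‖₊ / s t) ^ q * φ (s t)) ≤ φ (s t) := by
    intro t
    rw [← Finset.sum_mul]
    refine mul_le_of_le_one_left zero_le ?_
    calc ∑ k, (τ * ‖x k t‖₊ / s t) ^ q ≤ ∑ k, (τ * ‖x k t‖₊ / s t) ^ 2 := by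
          refine Finset.sum_le_sum fun k _ => ?_
          rcases (zero_le (a := τ * ‖x k t‖₊ / s t)).eq_or_lt with h | h
          · rw [← h, NNReal.zero_rpow (by linarith)]
            simp
          · rw [← NNReal.rpow_natCast]
            exact NNReal.rpow_le_rpow_of_exponent_ge h (div_le_one_of_le₀ (hxs1 k t) zero_le)
              (by exact_mod_cast hq)
      _ ≤ 1 := by
          simp only [div_pow]
          rw [← Finset.sum_div]
          exact div_le_one_of_le₀ (hxs t) zero_le
  have h1 := Finset.sum_le_sum fun k (_ : k ∈ Finset.univ) =>
    orliczNorm_rpow_le (by linarith) hup hV (hx k) hs hvs hφs hτ (hxs1 k)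
  have hm : ∀ k, Measurable fun t => (((τ * ‖x k t‖₊ / s t) ^ q * φ (s t) : ℝ≥0) : ℝ≥0∞) :=
    fun k => ((((x k).measurable.nnnorm.const_mul τ).div hs).pow_const q |>.mul
      (φ.measurable.comp hs)).coe_nnreal_ennreal
  rw [← Finset.mul_sum, ← lintegral_finsetSum _ fun k _ => hm k,
    ← ENNReal.ofReal_sum_of_nonneg fun k _ => Real.rpow_nonneg (orliczNorm_nonneg _) _] at h1
  have h2 : ∫⁻ t, ∑ k, (((τ * ‖x k t‖₊ / s t) ^ q * φ (s t) : ℝ≥0) : ℝ≥0∞) ∂μ ≤ 1 / 2 := by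
    refine le_trans (lintegral_mono fun t => ?_) hφs
    rw [← ENNReal.ofNNReal_finsetSum]
    exact ENNReal.coe_le_coe.2 (hpt t)
  have h3 : ENNReal.ofReal (∑ k, orliczNorm φ (x k) ^ q) ≤ ((K * (2 / τ) ^ q : ℝ≥0) : ℝ≥0∞) := by
    refine h1.trans ((mul_le_mul_right h2 _).trans (le_of_eq ?_))
    rw [ENNReal.coe_mul, mul_comm, ← mul_assoc]
    rw [one_div, ENNReal.coe_ofNat, ENNReal.inv_mul_cancel (by simp) (by simp), one_mul]
  rw [← ENNReal.ofReal_coe_nnreal, ENNReal.ofReal_le_ofReal_iff NNReal.zero_le_coe] at h3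
  exact_mod_cast h3

theorem orliczHasCotype_of_growth {p : ℝ} {c : ℝ≥0} (hq : 2 ≤ q) (hp : 0 < p) (hc : 0 < c)
    (hK : 0 < K)
    (hlow : ∀ a u : ℝ≥0, 1 ≤ a → v ≤ u → ((a * u : ℝ≥0) : ℝ≥0∞) ≤ V →
      c * a ^ p * φ u ≤ φ (a * u))
    (hup : ∀ a u : ℝ≥0, 1 ≤ a → v ≤ u → ((a * u : ℝ≥0) : ℝ≥0∞) ≤ V → φ (a * u) ≤ K * a ^ q * φ u)
    (hv : (φ v : ℝ≥0∞) * μ Set.univ ≤ 1 / 4)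
    (hV : ∀ g : Ω → ℝ≥0, Measurable g → ∫⁻ t, (φ (g t) : ℝ≥0∞) ∂μ ≤ 24 →
      ∀ᵐ t ∂μ, ((4 * g t : ℝ≥0) : ℝ≥0∞) ≤ V) :
    OrliczHasCotype μ φ q := by
  -- Chosen so that 24 / 96 = 1/4; the cut-off at `v` costs the other 1/4.
  obtain ⟨a, ha1, ha⟩ : ∃ a : ℝ≥0, 1 ≤ a ∧ 96 ≤ c * a ^ p := by
    obtain ⟨a, h1, h2⟩ := ((Filter.eventually_ge_atTop (1 : ℝ≥0)).and
      ((NNReal.tendsto_rpow_atTop hp).eventually_ge_atTop (96 / c))).exists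
    exact ⟨a, h1, by rwa [div_le_iff₀' hc] at h2⟩
  have ha0 : 0 < a := one_pos.trans_le ha1
  have hKpos : (0 : ℝ) < (K : ℝ) ^ (1 / q) * (100 * a) := by
    have : (0 : ℝ) < K := hK
    have : (0 : ℝ) < a := ha0
    positivity
  refine ⟨(K : ℝ) ^ (1 / q) * (100 * a), hKpos, fun n x => ?_⟩
  have hI := (integral_comp_rademacher n fun g =>
    orliczNorm φ ((∑ k, g k • x k : orliczSpace μ φ) : Ω →ₘ[μ] ℝ)).2
  beta_reduce
  rw [hI, ← div_le_iff₀' hKpos]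
  -- A strict upper bound `M` is positive even when the average vanishes.
  refine le_of_forall_gt_imp_ge_of_dense fun M hM => ?_
  have hM0 : 0 < M := lt_of_le_of_lt
    (mul_nonneg (by positivity) (Finset.sum_nonneg fun _ _ => orliczNorm_nonneg _)) hM
  have hsum : ∑ σ : Fin n → Bool, orliczNorm φ (∑ k, boolSign (σ k) • (x k : Ω →ₘ[μ] ℝ)) ≤
      2 ^ n * M := by
    rw [inv_mul_lt_iff₀ (by positivity)] at hM
    simpa using hM.le
  have hsq := lintegral_squareFunction_le (fun k => (x k : Ω →ₘ[μ] ℝ)) (fun k => (x k).2) hM0 hsum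
  set g : Ω → ℝ≥0 := fun t =>
    Real.toNNReal (√((∑ k, (x k : Ω →ₘ[μ] ℝ) t ^ 2) / 2) / (25 * M)) with hg
  have hgm : Measurable g := by
    have : ∀ k, Measurable ((x k : Ω →ₘ[μ] ℝ) : Ω → ℝ) := fun k => (x k : Ω →ₘ[μ] ℝ).measurable
    fun_prop
  have hgV := hV g hgm hsq
  have hφs : ∫⁻ t, (φ (max (g t / a) v) : ℝ≥0∞) ∂μ ≤ 1 / 2 := by
    have hpt : ∀ᵐ t ∂μ, (φ (max (g t / a) v) : ℝ≥0∞) ≤ φ v + (96 : ℝ≥0∞)⁻¹ * φ (g t) := by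
      filter_upwards [hgV] with t ht
      rcases le_total (g t / a) v with h | h
      · rw [max_eq_right h]
        exact le_self_add
      · rw [max_eq_left h]
        have e : a * (g t / a) = g t := mul_div_cancel₀ _ ha0.ne'
        have h1 := hlow a (g t / a) ha1 h (by
          rw [e]
          refine le_trans ?_ ht
          exact ENNReal.coe_le_coe.2 (le_mul_of_one_le_left zero_le (by norm_num)))
        rw [e] at h1
        have h2 : 96 * φ (g t / a) ≤ φ (g t) := (mul_le_mul_left ha _).trans h1
        have h3 : (96 : ℝ≥0∞) * φ (g t / a) ≤ φ (g t) := by exact_mod_cast h2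
        refine le_trans ?_ le_add_self
        rw [mul_comm, ← div_eq_mul_inv]
        rwa [ENNReal.le_div_iff_mul_le (by simp) (by simp), mul_comm]
    refine (lintegral_mono_ae hpt).trans ?_
    rw [lintegral_add_left measurable_const, lintegral_const, lintegral_const_mul' _ _ (by simp)]
    calc _ ≤ (1 / 4 : ℝ≥0∞) + 96⁻¹ * 24 := by gcongr
      _ = 1 / 2 := by
        rw [← ENNReal.toReal_eq_toReal_iff' (by finiteness) (by finiteness),
          ENNReal.toReal_add (by finiteness) (by finiteness)]
        norm_num
  obtain ⟨M', rfl⟩ : ∃ M' : ℝ≥0, (M' : ℝ) = M := ⟨Real.toNNReal M, Real.coe_toNNReal _ hM0.le⟩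
  have hM0' : 0 < M' := hM0
  have key := sum_orliczNorm_rpow_le hq hup hV (fun k => (x k).2)
    ((hgm.div_const a).max measurable_const) (fun t => le_max_right _ _) hφs
    -- The required domination amounts to `25 * √2 ≤ 50`.
    (τ := (50 * (M' * a))⁻¹) (by positivity) (fun t => by
      refine le_trans ?_ (pow_le_pow_left₀ zero_le (le_max_left (g t / a) v) 2)
      rw [← NNReal.coe_le_coe]
      have hs : 0 ≤ ∑ k, (x k : Ω →ₘ[μ] ℝ) t ^ 2 := Finset.sum_nonneg fun _ _ => sq_nonneg _
      have ha' : (0 : ℝ) < a := ha0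
      simp only [hg, NNReal.coe_sum, NNReal.coe_pow, NNReal.coe_mul, NNReal.coe_inv, coe_nnnorm,
        NNReal.coe_div, NNReal.coe_ofNat, mul_pow, Real.norm_eq_abs, sq_abs]
      rw [← Finset.mul_sum, Real.coe_toNNReal _ (by positivity), div_pow, div_pow,
        Real.sq_sqrt (by positivity)]
      rw [div_div, le_div_iff₀ (by positivity)]
      field_simp
      nlinarith)
  have hq0 : 0 < q := by linarith
  have e7 : (2 / (((50 * (M' * a))⁻¹ : ℝ≥0) : ℝ)) = 100 * a * M' := by
    push_cast
    field_simp
    norm_num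
  rw [e7] at key
  rw [div_le_iff₀ hKpos]
  calc _ ≤ ((K : ℝ) * (100 * a * M') ^ q) ^ (1 / q) :=
        Real.rpow_le_rpow (Finset.sum_nonneg fun _ _ => Real.rpow_nonneg (orliczNorm_nonneg _) _)
          key (by positivity)
    _ = _ := by
        rw [Real.mul_rpow (by positivity) (by positivity), ← Real.rpow_mul (by positivity),
          mul_one_div_cancel hq0.ne', Real.rpow_one]
        ring

end Sufficiency

/-! ### Intermediate values of non-atomic measures. -/

section Nonatomic

variable {Ω : Type*} [MeasurableSpace Ω] {μ : Measure Ω}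

theorem IsNonatomic.exists_subset_le_half (h : IsNonatomic μ) {A : Set Ω} (hA : MeasurableSet A)
    (hpos : 0 < μ A) (hfin : μ A ≠ ∞) :
    ∃ B ⊆ A, MeasurableSet B ∧ 0 < μ B ∧ μ B ≤ μ A / 2 := by
  obtain ⟨B, hBA, hB, hB0, hBlt⟩ := h A hA hpos
  rcases le_or_gt (μ B) (μ A / 2) with hle | hgt
  · exact ⟨B, hBA, hB, hB0, hle⟩
  · have hd : μ (A \ B) = μ A - μ B :=
      measure_sdiff hBA hB.nullMeasurableSet (ne_top_of_le_ne_top hfin (measure_mono hBA))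
    refine ⟨A \ B, Set.sdiff_subset, hA.diff hB, ?_, ?_⟩
    · rw [hd]
      exact tsub_pos_of_lt hBlt
    · rw [hd, tsub_le_iff_right]
      calc μ A = μ A / 2 + μ A / 2 := (ENNReal.add_halves _).symm
        _ ≤ _ := by gcongr

theorem IsNonatomic.exists_subset_le (h : IsNonatomic μ) {A : Set Ω} (hA : MeasurableSet A)
    (hpos : 0 < μ A) (hfin : μ A ≠ ∞) {ε : ℝ≥0∞} (hε : 0 < ε) :
    ∃ B ⊆ A, MeasurableSet B ∧ 0 < μ B ∧ μ B ≤ ε := by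
  have hn : ∀ n : ℕ, ∃ B ⊆ A, MeasurableSet B ∧ 0 < μ B ∧ μ B ≤ μ A * 2⁻¹ ^ n := by
    intro n
    induction n with
    | zero => exact ⟨A, subset_rfl, hA, hpos, by simp⟩
    | succ n ih =>
      obtain ⟨B, hBA, hB, hB0, hle⟩ := ih
      obtain ⟨C, hCB, hC, hC0, hCle⟩ := h.exists_subset_le_half hB hB0
        (ne_top_of_le_ne_top hfin (measure_mono hBA))
      refine ⟨C, hCB.trans hBA, hC, hC0, hCle.trans ?_⟩
      rw [pow_succ, ← mul_assoc, div_eq_mul_inv]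
      gcongr
  have ht : Filter.Tendsto (fun n : ℕ => μ A * 2⁻¹ ^ n) Filter.atTop (nhds (μ A * 0)) :=
    ENNReal.Tendsto.const_mul
      (ENNReal.tendsto_pow_atTop_nhds_zero_of_lt_one ENNReal.one_half_lt_one) (Or.inr hfin)
  rw [mul_zero] at ht
  obtain ⟨n, hle⟩ := (ht.eventually_le_const hε).exists
  obtain ⟨B, hBA, hB, hB0, hBle⟩ := hn n
  exact ⟨B, hBA, hB, hB0, hBle.trans hle⟩

/-- Sierpiński's theorem: a non-atomic measure takes all intermediate values. -/
theorem IsNonatomic.exists_subset_measure_eq (h : IsNonatomic μ) {A : Set Ω}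
    (hA : MeasurableSet A) (hfin : μ A ≠ ∞) {t : ℝ≥0∞} (ht : t ≤ μ A) :
    ∃ B ⊆ A, MeasurableSet B ∧ μ B = t := by
  let S := {B : Set Ω // B ⊆ A ∧ MeasurableSet B ∧ μ B ≤ t}
  have htop : t ≠ ∞ := ne_top_of_le_ne_top hfin ht
  -- Greedy exhaustion: each step gains at least half the measure of every admissible addition. If
  -- the union fell short of `t`, one small set `D` outside it would be admissible at all steps and
  -- force unbounded growth.
  have step : ∀ B : S, ∃ B' : S, B.1 ⊆ B'.1 ∧ ∀ D : Set Ω, MeasurableSet D → D ⊆ A \ B.1 →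
      μ D ≤ t - μ B.1 → μ B.1 + μ D / 2 ≤ μ B'.1 := by
    intro B
    set T := {r | ∃ D : Set Ω, MeasurableSet D ∧ D ⊆ A \ B.1 ∧ μ D ≤ t - μ B.1 ∧ μ D = r} with hT
    have hsup : sSup T ≤ t := by
      refine sSup_le ?_
      rintro r ⟨D, -, -, hD, rfl⟩
      exact hD.trans tsub_le_self
    rcases eq_or_ne (sSup T) 0 with h0 | h0
    · refine ⟨B, subset_rfl, fun D hD hDA hDt => ?_⟩
      have : μ D ≤ sSup T := le_sSup ⟨D, hD, hDA, hDt, rfl⟩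
      rw [h0, nonpos_iff_eq_zero] at this
      simp [this]
    · obtain ⟨r, ⟨C, hC, hCA, hCt, rfl⟩, hlt⟩ :=
        lt_sSup_iff.1 (ENNReal.half_lt_self h0 (ne_top_of_le_ne_top htop hsup))
      have hU : μ (B.1 ∪ C) = μ B.1 + μ C :=
        measure_union (Set.disjoint_of_subset_right hCA Set.disjoint_sdiff_right) hC
      refine ⟨⟨B.1 ∪ C, Set.union_subset B.2.1 (hCA.trans Set.sdiff_subset),
        B.2.2.1.union hC, ?_⟩, Set.subset_union_left, fun D hD hDA hDt => ?_⟩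
      · rw [hU]
        exact (add_le_add_right hCt _).trans (add_tsub_cancel_of_le B.2.2.2).le
      · rw [hU]
        gcongr
        refine le_trans ?_ hlt.le
        gcongr
        exact le_sSup ⟨D, hD, hDA, hDt, rfl⟩
  choose next hsub hnext using step
  let B : ℕ → S := fun n => Nat.rec ⟨∅, by simp⟩ (fun _ => next) n
  have hBsucc : ∀ n, B (n + 1) = next (B n) := fun _ => rfl
  have hmono : Monotone fun n => (B n).1 :=
    monotone_nat_of_le_succ fun n => by rw [hBsucc]; exact hsub _
  set U := ⋃ n, (B n).1 with hU
  have hUm : MeasurableSet U := MeasurableSet.iUnion fun n => (B n).2.2.1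
  have hUA : U ⊆ A := Set.iUnion_subset fun n => (B n).2.1
  have hUt : μ U ≤ t := by
    rw [hU, hmono.measure_iUnion]
    exact iSup_le fun n => (B n).2.2.2
  refine ⟨U, hUA, hUm, hUt.antisymm (not_lt.1 fun hlt => ?_)⟩
  have hd : μ (A \ U) = μ A - μ U :=
    measure_sdiff hUA hUm.nullMeasurableSet (ne_top_of_le_ne_top hfin (measure_mono hUA))
  obtain ⟨D, hDA, hD, hD0, hDle⟩ := h.exists_subset_le (hA.diff hUm)
    (by rw [hd]; exact tsub_pos_of_lt (hlt.trans_le ht))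
    (ne_top_of_le_ne_top hfin (measure_mono Set.sdiff_subset)) (tsub_pos_of_lt hlt)
  have hgrow : ∀ n : ℕ, n * (μ D / 2) ≤ μ (B n).1 := by
    intro n
    induction n with
    | zero => simp
    | succ n ih =>
      rw [hBsucc]
      refine le_trans ?_ (hnext (B n) D hD
        (hDA.trans (Set.sdiff_subset_sdiff_right (Set.subset_iUnion (fun n => (B n).1) n)))
        (hDle.trans (tsub_le_tsub_left (measure_mono (Set.subset_iUnion (fun n => (B n).1) n)) _)))
      push_cast
      rw [add_mul, one_mul]
      gcongr
  obtain ⟨n, hn⟩ := ENNReal.exists_nat_mul_gt (ENNReal.half_pos hD0.ne').ne' htop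
  exact (hn.trans_le ((hgrow n).trans (B n).2.2.2)).false

theorem IsNonatomic.exists_disjoint_measure_eq (h : IsNonatomic μ) {t : ℝ≥0∞} (n : ℕ) :
    ∀ {A : Set Ω}, MeasurableSet A → μ A ≠ ∞ → n * t ≤ μ A →
      ∃ f : Fin n → Set Ω, (∀ k, f k ⊆ A) ∧ (∀ k, MeasurableSet (f k)) ∧ (∀ k, μ (f k) = t) ∧
        Pairwise (Function.onFun Disjoint f) := by
  induction n with
  | zero => exact fun _ _ _ => ⟨Fin.elim0, fun k => k.elim0, fun k => k.elim0, fun k => k.elim0,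
      fun k => k.elim0⟩
  | succ n ih =>
    intro A hA hfin hle
    push_cast at hle
    rw [add_mul, one_mul] at hle
    obtain ⟨B, hBA, hB, hBt⟩ := h.exists_subset_measure_eq hA hfin (le_add_self.trans hle)
    have ht : t ≠ ∞ := ne_top_of_le_ne_top hfin (le_add_self.trans hle)
    obtain ⟨f, hfA, hf, hft, hdis⟩ := ih (hA.diff hB)
      (ne_top_of_le_ne_top hfin (measure_mono Set.sdiff_subset)) (by
        rw [measure_sdiff hBA hB.nullMeasurableSet (by rwa [hBt]), hBt]
        exact ENNReal.le_sub_of_add_le_right ht hle)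
    have hBf : ∀ k, Disjoint B (f k) := fun k =>
      Set.disjoint_of_subset_right (hfA k) Set.disjoint_sdiff_right
    refine ⟨Fin.cons B f, Fin.cases hBA fun k => (hfA k).trans Set.sdiff_subset,
      Fin.cases hB hf, Fin.cases hBt hft, ?_⟩
    intro i j
    refine Fin.cases ?_ (fun i => ?_) i <;> refine Fin.cases ?_ (fun j => ?_) j
    · simp
    · exact fun _ => hBf j
    · exact fun _ => (hBf i).symm
    · exact fun hij => hdis fun e => hij (congrArg _ e)

end Nonatomic

/-! ### From cotype to the upper growth condition. -/

section Necessity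

variable {Ω : Type*} [MeasurableSpace Ω] {μ : Measure Ω} {φ : OrliczFunction}

/-- The class of the indicator function of a measurable set. -/
noncomputable def aeIndicator (μ : Measure Ω) {A : Set Ω} (hA : MeasurableSet A) : Ω →ₘ[μ] ℝ :=
  AEEqFun.mk (A.indicator fun _ => (1 : ℝ)) (measurable_const.indicator hA).aestronglyMeasurable

theorem coeFn_aeIndicator {A : Set Ω} (hA : MeasurableSet A) :
    aeIndicator μ hA =ᵐ[μ] A.indicator fun _ => (1 : ℝ) := AEEqFun.coeFn_mk _ _

theorem orliczModular_smul_aeIndicator {A : Set Ω} (hA : MeasurableSet A) (c : ℝ) :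
    orliczModular φ (c • aeIndicator μ hA) = φ ‖c‖₊ * μ A := by
  rw [orliczModular_smul, ← lintegral_indicator_const hA]
  apply lintegral_congr_ae
  filter_upwards [coeFn_aeIndicator (μ := μ) hA] with t ht
  rw [ht]
  by_cases h : t ∈ A <;> simp [h, φ.map_zero']

theorem aeIndicator_mem_orliczSpace {A : Set Ω} (hA : MeasurableSet A) (hfin : μ A ≠ ∞) :
    aeIndicator μ hA ∈ orliczSpace μ φ :=
  ⟨1, one_pos, by
    rw [orliczModular_smul_aeIndicator]
    exact ENNReal.mul_lt_top ENNReal.coe_lt_top hfin.lt_top⟩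

theorem le_orliczNorm_aeIndicator {A : Set Ω} (hA : MeasurableSet A) {w : ℝ≥0} (hw : 0 < w)
    (h : μ A = (φ w : ℝ≥0∞)⁻¹) : (w : ℝ)⁻¹ ≤ orliczNorm φ (aeIndicator μ hA) := by
  have hφw : (φ w : ℝ≥0∞) ≠ 0 := by simpa using (φ.pos hw).ne'
  have hw' : (0 : ℝ) < w := hw
  refine le_csInf ⟨(w : ℝ)⁻¹, by positivity, ?_⟩ fun ε hε => ?_
  · rw [orliczModular_smul_aeIndicator, h]
    simp [ENNReal.mul_inv_cancel hφw]
  · obtain ⟨hε0, hle⟩ := hε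
    rw [orliczModular_smul_aeIndicator, h, ← div_eq_mul_inv, ENNReal.div_le_iff hφw (by simp),
      one_mul] at hle
    have h1 := φ.strictMono'.le_iff_le.1 (ENNReal.coe_le_coe.1 hle)
    rw [← NNReal.coe_le_coe, coe_nnnorm, Real.norm_of_nonneg (by positivity)] at h1
    exact inv_le_of_inv_le₀ hε0 h1

theorem orliczNorm_sum_smul_aeIndicator_le {n : ℕ} {A : Fin n → Set Ω}
    (hA : ∀ k, MeasurableSet (A k)) (hdis : Pairwise (Function.onFun Disjoint A)) {u w : ℝ≥0}
    (hu : 0 < u) (hw : 0 < w) (hμ : ∀ k, μ (A k) = (φ w : ℝ≥0∞)⁻¹) (hn : n * φ u ≤ φ w)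
    {r : Fin n → ℝ} (hr : ∀ k, |r k| ≤ 1) :
    orliczNorm φ (∑ k, r k • aeIndicator μ (hA k)) ≤ (u : ℝ)⁻¹ := by
  have hφw : (φ w : ℝ≥0∞) ≠ 0 := by simpa using (φ.pos hw).ne'
  have hu' : (0 : ℝ) < u := hu
  refine orliczNorm_le (by positivity) ?_
  rw [inv_inv, orliczModular_smul]
  calc _ ≤ ∫⁻ t, (⋃ k, A k).indicator (fun _ => (φ u : ℝ≥0∞)) t ∂μ := by
        refine lintegral_mono_ae ?_
        filter_upwards [coeFn_sum_smul Finset.univ r fun k => aeIndicator μ (hA k),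
          ae_all_iff.2 fun k => coeFn_aeIndicator (μ := μ) (hA k)] with t h1 h2
        rw [h1]
        simp only [h2]
        by_cases ht : t ∈ ⋃ k, A k
        · obtain ⟨j, hj⟩ := Set.mem_iUnion.1 ht
          rw [Set.indicator_of_mem ht, Finset.sum_eq_single j (fun k _ hk => ?_) (by simp)]
          · refine ENNReal.coe_le_coe.2 (φ.monotone ?_)
            rw [← NNReal.coe_le_coe]
            simpa [hj] using mul_le_of_le_one_right hu'.le (hr j)
          · rw [Set.indicator_of_notMem fun hk' => (hdis hk).le_bot ⟨hk', hj⟩, mul_zero]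
        · rw [Set.indicator_of_notMem ht, Finset.sum_eq_zero fun k _ => ?_]
          · simp [φ.map_zero']
          · rw [Set.indicator_of_notMem fun hk => ht (Set.mem_iUnion.2 ⟨k, hk⟩), mul_zero]
    _ = φ u * μ (⋃ k, A k) := lintegral_indicator_const (MeasurableSet.iUnion hA) _
    _ ≤ φ u * ∑ k, μ (A k) := by
        gcongr
        exact measure_iUnion_fintype_le μ A
    _ = ((n * φ u : ℝ≥0) : ℝ≥0∞) * (φ w : ℝ≥0∞)⁻¹ := by
        simp [hμ]
        ring
    _ ≤ (φ w : ℝ≥0∞) * (φ w : ℝ≥0∞)⁻¹ := by gcongr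
    _ = 1 := ENNReal.mul_inv_cancel hφw (by simp)

/-- The lower estimate of the norm on disjoint sets of equal measure implied by cotype `q`. -/
theorem OrliczHasCotype.exists_forall_rpow_mul_le {q : ℝ} (hq : 0 < q)
    (h : OrliczHasCotype μ φ q) :
    ∃ K : ℝ≥0, 0 < K ∧ ∀ (n : ℕ) (A : Fin n → Set Ω), (∀ k, MeasurableSet (A k)) →
      Pairwise (Function.onFun Disjoint A) → ∀ u w : ℝ≥0, 0 < u → 0 < w →
      (∀ k, μ (A k) = (φ w : ℝ≥0∞)⁻¹) → n * φ u ≤ φ w → (n : ℝ≥0) ^ (1 / q) * u ≤ K * w := by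
  obtain ⟨K, hK, h⟩ := h
  refine ⟨Real.toNNReal K, by simpa using hK, fun n A hA hdis u w hu hw hμ hn => ?_⟩
  have hu' : (0 : ℝ) < u := hu
  have hw' : (0 : ℝ) < w := hw
  have hfin : ∀ k, μ (A k) ≠ ∞ := fun k => by
    rw [hμ]
    simpa using (φ.pos hw).ne'
  have h1 := h n fun k => ⟨aeIndicator μ (hA k), aeIndicator_mem_orliczSpace (hA k) (hfin k)⟩
  have h2 : ∫ t in (0 : ℝ)..1, orliczNorm φ
      ((∑ k : Fin n, rademacher ((k : ℕ) + 1) t •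
        (⟨aeIndicator μ (hA k), aeIndicator_mem_orliczSpace (hA k) (hfin k)⟩ :
          orliczSpace μ φ) : orliczSpace μ φ) : Ω →ₘ[μ] ℝ) ≤ (u : ℝ)⁻¹ := by
    refine (le_abs_self _).trans ?_
    rw [← Real.norm_eq_abs]
    refine (intervalIntegral.norm_integral_le_of_norm_le_const (C := (u : ℝ)⁻¹)
      fun t _ => ?_).trans (by simp)
    rw [Real.norm_of_nonneg (orliczNorm_nonneg _)]
    have := orliczNorm_sum_smul_aeIndicator_le hA hdis hu hw hμ hn
      (r := fun k => rademacher ((k : ℕ) + 1) t) fun k => abs_rademacher_le_one _ _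
    simpa using this
  have h3 : (n : ℝ) ^ (1 / q) * (w : ℝ)⁻¹ ≤ (∑ k, orliczNorm φ (aeIndicator μ (hA k)) ^ q) ^
      (1 / q) := by
    have : (n : ℝ) * ((w : ℝ)⁻¹) ^ q ≤ ∑ k, orliczNorm φ (aeIndicator μ (hA k)) ^ q := by
      rw [← nsmul_eq_mul]
      have := Finset.card_nsmul_le_sum Finset.univ
        (fun k => orliczNorm φ (aeIndicator μ (hA k)) ^ q) (((w : ℝ)⁻¹) ^ q) fun k _ =>
          Real.rpow_le_rpow (by positivity) (le_orliczNorm_aeIndicator (hA k) hw (hμ k)) hq.le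
      simpa using this
    refine le_trans (le_of_eq ?_) (Real.rpow_le_rpow (by positivity) this (by positivity))
    rw [Real.mul_rpow (by positivity) (by positivity), ← Real.rpow_mul (by positivity),
      mul_one_div_cancel hq.ne', Real.rpow_one]
  have h4 : (n : ℝ) ^ (1 / q) * (w : ℝ)⁻¹ ≤ K * (u : ℝ)⁻¹ :=
    h3.trans (h1.trans (mul_le_mul_of_nonneg_left h2 hK.le))
  rw [← NNReal.coe_le_coe]
  push_cast
  rw [Real.coe_toNNReal _ hK.le]
  rw [← div_eq_mul_inv, ← div_eq_mul_inv, div_le_div_iff₀ hw' hu'] at h4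
  exact h4

/-- The integer is `(K * a) ^ q` rounded up; the extra 1 is absorbed by `a ^ q ≥ 1`. -/
theorem exists_nat_rpow_bounds {q : ℝ} (hq : 0 < q) {K : ℝ≥0} (hK : 0 < K) {a : ℝ≥0}
    (ha : 1 ≤ a) : ∃ n : ℕ, 0 < n ∧ (n : ℝ≥0) ≤ (K ^ q + 1) * a ^ q ∧
      ∀ u w : ℝ≥0, (n : ℝ≥0) ^ (1 / q) * u ≤ K * w → a * u ≤ w := by
  have ha0 : 0 < a := one_pos.trans_le ha
  refine ⟨⌈(K * a) ^ q⌉₊, Nat.ceil_pos.2 (NNReal.rpow_pos (by positivity)), ?_, fun u w h => ?_⟩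
  · refine (Nat.ceil_lt_add_one zero_le).le.trans ?_
    rw [NNReal.mul_rpow, add_mul, one_mul]
    gcongr
    exact NNReal.one_le_rpow ha hq.le
  · have h1 : K * a ≤ ((⌈(K * a) ^ q⌉₊ : ℕ) : ℝ≥0) ^ (1 / q) := by
      rw [one_div, NNReal.le_rpow_inv_iff hq]
      exact Nat.le_ceil _
    have h2 : K * (a * u) ≤ K * w := by
      rw [← mul_assoc]
      exact (mul_le_mul_left h1 u).trans h
    exact le_of_mul_le_mul_left h2 hK

/-- With `φ w = n * φ u`, the `n` sets have total measure `1 / φ u`, which is why only a set of that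
size is needed. -/
theorem OrliczHasCotype.exists_upper_growth {q : ℝ} (hq : 0 < q) (h : OrliczHasCotype μ φ q)
    (hμ : IsNonatomic μ) : ∃ K : ℝ≥0, 0 < K ∧ ∀ a u : ℝ≥0, 1 ≤ a → 0 < u →
      (∃ A : Set Ω, MeasurableSet A ∧ μ A ≠ ∞ ∧ (φ u : ℝ≥0∞)⁻¹ ≤ μ A) →
        φ (a * u) ≤ K * a ^ q * φ u := by
  obtain ⟨K, hK, h⟩ := h.exists_forall_rpow_mul_le hq
  refine ⟨K ^ q + 1, by positivity, fun a u ha hu ⟨A, hA, hfin, hle⟩ => ?_⟩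
  obtain ⟨n, hn0, hn, hau⟩ := exists_nat_rpow_bounds hq hK ha
  have hφu := φ.pos hu
  obtain ⟨w, hw0, hw⟩ := φ.exists_pos_eq (y := n * φ u) (by positivity)
  have hnt : (n : ℝ≥0∞) * (φ w : ℝ≥0∞)⁻¹ ≤ μ A := by
    refine le_trans (le_of_eq ?_) hle
    rw [hw, ENNReal.coe_mul, ENNReal.coe_natCast, ENNReal.mul_inv (by simp) (by simp), ← mul_assoc,
      ENNReal.mul_inv_cancel (by simpa using hn0.ne') (by simp), one_mul]
  obtain ⟨f, -, hf, hft, hdis⟩ := hμ.exists_disjoint_measure_eq n hA hfin hnt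
  have h1 := hau u w (h n f hf hdis u w hu hw0 hft hw.ge)
  calc φ (a * u) ≤ φ w := φ.monotone h1
    _ = n * φ u := hw
    _ ≤ _ := by gcongr

theorem OrliczHasCotype.deltaUpper_small {q : ℝ} (hq : 0 < q)
    (h : OrliczHasCotype (Measure.count : Measure ℕ) φ q) : DeltaUpper φ q .small := by
  obtain ⟨K, hK, h⟩ := h.exists_forall_rpow_mul_le hq
  obtain ⟨v, hv0, hv⟩ := φ.exists_pos_eq one_pos
  refine ⟨2 * (K ^ q + 1), by positivity, v, hv0, fun a u ha hle => ?_⟩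
  rcases (zero_le (a := u)).eq_or_lt with h0 | hu
  · simp [← h0, φ.map_zero']
  obtain ⟨n, hn0, hn, hau⟩ := exists_nat_rpow_bounds hq hK ha
  have hφu := φ.pos hu
  have hb : n * φ u ≤ (K ^ q + 1) * a ^ q * φ u := by gcongr
  suffices φ (a * u) ≤ 2 * (n * φ u) by
    refine this.trans ((mul_le_mul_right hb 2).trans (le_of_eq ?_))
    ring
  rcases le_or_gt (n * φ u) 1 with h1 | h1
  · set y := n * φ u with hy
    have hy0 : 0 < y := by positivity
    -- Counting measure allows only integer sizes: blocks of length `m` replace measure `1 / y`. As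
    -- `1 / y ≥ 1`, rounding down loses at most a factor 2.
    set m := ⌊y⁻¹⌋₊ with hm
    have hm1 : 1 ≤ m := Nat.le_floor (by simpa using (one_le_inv₀ hy0).2 h1)
    have hm0 : (0 : ℝ≥0) < m := by exact_mod_cast hm1
    obtain ⟨w, hw0, hw⟩ := φ.exists_pos_eq (inv_pos.2 hm0)
    have hyw : y ≤ φ w := by
      rw [hw, le_inv_comm₀ hy0 hm0]
      exact Nat.floor_le zero_le
    have h2 := hau u w (h n (fun k => Set.Ico ((k : ℕ) * m) (((k : ℕ) + 1) * m))
      (fun k => measurableSet_Ico) ?_ u w hu hw0 (fun k => ?_) hyw)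
    · refine (φ.monotone h2).trans ?_
      rw [hw, inv_le_iff_one_le_mul₀ hm0]
      have h3 : y⁻¹ ≤ 2 * m := by
        refine (Nat.lt_floor_add_one _).le.trans ?_
        rw [← hm, two_mul]
        gcongr
        exact_mod_cast hm1
      calc 1 = y⁻¹ * y := (inv_mul_cancel₀ hy0.ne').symm
        _ ≤ 2 * m * y := by gcongr
        _ = _ := by ring
    · have : Pairwise (Function.onFun Disjoint fun k : ℕ => Set.Ico (k * m) ((k + 1) * m)) := by
        have := (show Monotone fun k : ℕ => k * m from
          fun i j hij => Nat.mul_le_mul_right m hij).pairwise_disjoint_on_Ico_succ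
        simpa using this
      exact fun i j hij => this fun e => hij (Fin.ext e)
    · rw [hw, ← Finset.coe_Ico, Measure.count_apply_finset, Nat.card_Ico,
        ← Nat.sub_mul, Nat.add_sub_cancel_left, one_mul, ENNReal.coe_inv hm0.ne', inv_inv]
      simp
  -- No integer block fits here, but `φ v = 1` already bounds the left side.
  · calc φ (a * u) ≤ φ v := φ.monotone hle
      _ = 1 := hv
      _ ≤ n * φ u := h1.le
      _ ≤ _ := le_mul_of_one_le_left zero_le one_le_two

end Necessity

/-! ### Moving the thresholds of the growth conditions. -/

section GrowthConditions

variable {φ : OrliczFunction} {p q : ℝ}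

theorem exists_lowerGrowth_of_lowerIndex_pos {R : ArgRange} (h : 0 < lowerIndex φ R) :
    ∃ p : ℝ, 0 < p ∧ LowerGrowth φ p R := by
  obtain ⟨_, ⟨p, hp, rfl⟩, h0⟩ := lt_sSup_iff.1 h
  exact ⟨p, EReal.coe_pos.1 h0, hp⟩

/-- For `u` below the old threshold, start from `W` instead: `v ≤ u` makes `(v / W) * a` at most `a
* u / W`, so a factor `(v / W) ^ p` pays for the change. -/
theorem LowerGrowth.large_ge (hp : 0 < p) (h : LowerGrowth φ p .large) {v : ℝ≥0} (hv : 0 < v) :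
    ∃ c : ℝ≥0, 0 < c ∧ ∀ a u : ℝ≥0, 1 ≤ a → v ≤ u → c * a ^ p * φ u ≤ φ (a * u) := by
  obtain ⟨c, hc, w, h⟩ := h
  set W := max v w with hW
  have hvW : v ≤ W := le_max_left _ _
  have hW0 : 0 < W := hv.trans_le hvW
  have hd1 : (v / W) ^ p ≤ 1 := NNReal.rpow_le_one (div_le_one_of_le₀ hvW zero_le) hp.le
  refine ⟨min c 1 * (v / W) ^ p, mul_pos (lt_min hc one_pos)
    (NNReal.rpow_pos (div_pos hv hW0)), fun a u ha hu => ?_⟩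
  rcases le_or_gt W u with h1 | h1
  · refine le_trans ?_ (h a u ha ((le_max_right _ _).trans h1))
    gcongr
    exact (mul_le_of_le_one_right zero_le hd1).trans (min_le_left _ _)
  · have hre : min c 1 * (v / W) ^ p * a ^ p = min c 1 * (v / W * a) ^ p := by
      rw [NNReal.mul_rpow, mul_assoc]
    have hle : v / W * a ≤ a * u / W := by
      rw [div_mul_eq_mul_div, mul_comm]
      gcongr
    rw [hre]
    rcases le_or_gt (a * u) W with h2 | h2
    · calc min c 1 * (v / W * a) ^ p * φ u ≤ 1 * 1 * φ u := by
            gcongr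
            · exact min_le_right _ _
            · exact NNReal.rpow_le_one (hle.trans (div_le_one_of_le₀ h2 zero_le)) hp.le
        _ = φ u := by ring
        _ ≤ φ (a * u) := φ.monotone (le_mul_of_one_le_left zero_le ha)
    · calc min c 1 * (v / W * a) ^ p * φ u ≤ c * (a * u / W) ^ p * φ W := by
            gcongr
            · exact min_le_left _ _
            · exact φ.monotone h1.le
        _ ≤ φ (a * u / W * W) := h _ _ ((one_le_div hW0).2 h2.le) (le_max_right _ _)
        _ = φ (a * u) := by rw [div_mul_cancel₀ _ hW0.ne']

theorem DeltaUpper.large_ge (h : DeltaUpper φ q .large) {v : ℝ≥0} (hv : 0 < v) :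
    ∃ K : ℝ≥0, 0 < K ∧ ∀ a u : ℝ≥0, 1 ≤ a → v ≤ u → φ (a * u) ≤ K * a ^ q * φ u := by
  obtain ⟨K, hK, w, h⟩ := h
  set W := max v w with hW
  have hvW : v ≤ W := le_max_left _ _
  have hφv := φ.pos hv
  have hd : 1 ≤ φ W / φ v := (one_le_div hφv).2 (φ.monotone hvW)
  refine ⟨K * (φ W / φ v), mul_pos hK (one_pos.trans_le hd), fun a u ha hu => ?_⟩
  rcases le_or_gt W u with h1 | h1
  · refine (h a u ha ((le_max_right _ _).trans h1)).trans ?_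
    gcongr
    exact le_mul_of_one_le_right zero_le hd
  · calc φ (a * u) ≤ φ (a * W) := φ.monotone (mul_le_mul_right h1.le _)
      _ ≤ K * a ^ q * φ W := h a W ha (le_max_right _ _)
      _ = K * a ^ q * (φ W / φ v * φ v) := by rw [div_mul_cancel₀ _ hφv.ne']
      _ ≤ K * a ^ q * (φ W / φ v * φ u) := by
          gcongr
          exact φ.monotone hu
      _ = _ := by ring

theorem LowerGrowth.small_le (hp : 0 < p) (h : LowerGrowth φ p .small) (V : ℝ≥0) :
    ∃ c : ℝ≥0, 0 < c ∧ ∀ a u : ℝ≥0, 1 ≤ a → a * u ≤ V → c * a ^ p * φ u ≤ φ (a * u) := by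
  obtain ⟨c, hc, v, hv, h⟩ := h
  set W := max v V with hW
  have hvW : v ≤ W := le_max_left _ _
  have hW0 : 0 < W := hv.trans_le hvW
  have hd1 : (v / W) ^ p ≤ 1 := NNReal.rpow_le_one (div_le_one_of_le₀ hvW zero_le) hp.le
  refine ⟨min c 1 * (v / W) ^ p, mul_pos (lt_min hc one_pos)
    (NNReal.rpow_pos (div_pos hv hW0)), fun a u ha hu => ?_⟩
  have huW : a * u ≤ W := hu.trans (le_max_right _ _)
  rcases (zero_le (a := u)).eq_or_lt with h0 | hu0
  · simp [← h0, φ.map_zero']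
  rcases le_or_gt (a * u) v with h1 | h1
  · refine le_trans ?_ (h a u ha hu0 h1)
    gcongr
    exact (mul_le_of_le_one_right zero_le hd1).trans (min_le_left _ _)
  · have hle : v / W * a ≤ v / u := by
      rw [div_mul_eq_mul_div, div_le_div_iff₀ hW0 hu0, mul_assoc]
      gcongr
    rw [mul_assoc (min c 1), ← NNReal.mul_rpow]
    rcases le_or_gt v u with h2 | h2
    · calc min c 1 * (v / W * a) ^ p * φ u ≤ 1 * 1 * φ u := by
            gcongr
            · exact min_le_right _ _
            · exact NNReal.rpow_le_one (hle.trans (div_le_one_of_le₀ h2 zero_le)) hp.le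
        _ = φ u := by ring
        _ ≤ φ (a * u) := φ.monotone (le_mul_of_one_le_left zero_le ha)
    · have e : v / u * u = v := div_mul_cancel₀ _ hu0.ne'
      calc min c 1 * (v / W * a) ^ p * φ u ≤ c * (v / u) ^ p * φ u := by
            gcongr
            exact min_le_left _ _
        _ ≤ φ (v / u * u) := h _ _ ((one_le_div hu0).2 h2.le) hu0 e.le
        _ ≤ φ (a * u) := φ.monotone (e.le.trans h1.le)

/-- Beyond `v`, the value `φ (a * u)` is at most `φ W`, a fixed multiple of `φ v`, and `φ v` is
controlled by growth from `u` up to `v`. -/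
theorem DeltaUpper.small_le (hq : 0 < q) (h : DeltaUpper φ q .small) (V : ℝ≥0) :
    ∃ K : ℝ≥0, 0 < K ∧ ∀ a u : ℝ≥0, 1 ≤ a → a * u ≤ V → φ (a * u) ≤ K * a ^ q * φ u := by
  obtain ⟨K, hK, v, hv, h⟩ := h
  set W := max v V with hW
  have hvW : v ≤ W := le_max_left _ _
  have hφv := φ.pos hv
  have hd : 1 ≤ φ W / φ v := (one_le_div hφv).2 (φ.monotone hvW)
  refine ⟨max K 1 * (φ W / φ v), mul_pos (lt_max_of_lt_left hK) (one_pos.trans_le hd),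
    fun a u ha hu => ?_⟩
  have huW : a * u ≤ W := hu.trans (le_max_right _ _)
  rcases le_or_gt (a * u) v with h1 | h1
  · refine (h a u ha h1).trans ?_
    gcongr
    exact (le_max_left _ _).trans (le_mul_of_one_le_right zero_le hd)
  · have key : φ v ≤ max K 1 * a ^ q * φ u := by
      rcases le_or_gt v u with h2 | h2
      · exact (φ.monotone h2).trans (le_mul_of_one_le_left zero_le
          (one_le_mul (le_max_right _ _) (NNReal.one_le_rpow ha hq.le)))
      · have hu0 : 0 < u := by
          rcases (zero_le (a := u)).eq_or_lt with h0 | h0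
          · simp [← h0] at h1
          · exact h0
        have e : v / u * u = v := div_mul_cancel₀ _ hu0.ne'
        calc φ v = φ (v / u * u) := by rw [e]
          _ ≤ K * (v / u) ^ q * φ u := h _ _ ((one_le_div hu0).2 h2.le) e.le
          _ ≤ _ := by
            gcongr
            · exact le_max_left _ _
            · exact (div_le_iff₀ hu0).2 h1.le
    calc φ (a * u) ≤ φ W := φ.monotone huW
      _ = φ W / φ v * φ v := (div_mul_cancel₀ _ hφv.ne').symm
      _ ≤ φ W / φ v * (max K 1 * a ^ q * φ u) := by gcongr
      _ = _ := by ring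

end GrowthConditions

/-! ### The three measure spaces. -/

theorem mainTheorem2 (q : ℝ) (hq : 2 ≤ q) (φ : OrliczFunction) :
    (∀ (Ω : Type u) [MeasurableSpace Ω] (μ : Measure Ω) [SigmaFinite μ],
      IsNonatomic μ → μ Set.univ = ∞ → 0 < lowerIndex φ .all →
        (OrliczHasCotype μ φ q ↔ DeltaUpper φ q .all)) ∧
    (∀ (Ω : Type u) [MeasurableSpace Ω] (μ : Measure Ω) [IsFiniteMeasure μ],
      IsNonatomic μ → μ ≠ 0 → 0 < lowerIndex φ .large →
        (OrliczHasCotype μ φ q ↔ DeltaUpper φ q .large)) ∧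
    (0 < lowerIndex φ .small →
      (OrliczHasCotype (Measure.count : Measure ℕ) φ q ↔ DeltaUpper φ q .small)) := by
  have hq0 : 0 < q := by linarith
  refine ⟨fun Ω _ μ _ hμ huniv hα => ⟨fun h => ?_, fun h => ?_⟩,
    fun Ω _ μ _ hμ hne hα => ⟨fun h => ?_, fun h => ?_⟩,
    fun hα => ⟨OrliczHasCotype.deltaUpper_small hq0, fun h => ?_⟩⟩
  · obtain ⟨K, hK, hle⟩ := h.exists_upper_growth hq0 hμ
    refine ⟨K, hK, fun a u ha => ?_⟩
    rcases (zero_le (a := u)).eq_or_lt with h0 | hu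
    · simp [← h0, φ.map_zero']
    refine hle a u ha hu ?_
    have hlt : (φ u : ℝ≥0∞)⁻¹ < μ Set.univ := by
      rw [huniv]
      simpa [lt_top_iff_ne_top] using (φ.pos hu).ne'
    obtain ⟨A, hA, -, h1, h2⟩ :=
      Measure.exists_subset_measure_lt_top MeasurableSet.univ hlt
    exact ⟨A, hA, h2.ne, h1.le⟩
  · obtain ⟨p, hp, c, hc, hlow⟩ := exists_lowerGrowth_of_lowerIndex_pos hα
    obtain ⟨K, hK, hup⟩ := h
    exact orliczHasCotype_of_growth (v := 0) (V := ∞) hq hp hc hK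
      (fun a u ha _ _ => hlow a u ha) (fun a u ha _ _ => hup a u ha)
      (by simp [φ.map_zero']) (fun _ _ _ => by simp)
  · obtain ⟨K, hK, hle⟩ := h.exists_upper_growth hq0 hμ
    have hm0 : 0 < (μ Set.univ).toNNReal :=
      ENNReal.toNNReal_pos (by simpa using hne) (measure_ne_top _ _)
    obtain ⟨v, hv, hφv⟩ := φ.exists_pos_eq (inv_pos.2 hm0)
    refine ⟨K, hK, v, fun a u ha hu => hle a u ha (hv.trans_le hu)
      ⟨Set.univ, MeasurableSet.univ, measure_ne_top _ _, ?_⟩⟩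
    rw [ENNReal.inv_le_iff_inv_le, ← ENNReal.coe_toNNReal (measure_ne_top μ Set.univ),
      ← ENNReal.coe_inv hm0.ne', ← hφv]
    exact ENNReal.coe_le_coe.2 (φ.monotone hu)
  · obtain ⟨p, hp, hlow⟩ := exists_lowerGrowth_of_lowerIndex_pos hα
    have hm0 : 0 < (μ Set.univ).toNNReal :=
      ENNReal.toNNReal_pos (by simpa using hne) (measure_ne_top _ _)
    -- The constant `v` then has modular exactly 1/4, as the cut-off requires.
    obtain ⟨v, hv, hφv⟩ := φ.exists_pos_eq (y := 4⁻¹ * (μ Set.univ).toNNReal⁻¹) (by positivity)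
    obtain ⟨c, hc, hlow⟩ := hlow.large_ge hp hv
    obtain ⟨K, hK, hup⟩ := h.large_ge hv
    refine orliczHasCotype_of_growth (v := v) (V := ∞) hq hp hc hK
      (fun a u ha hu _ => hlow a u ha hu) (fun a u ha hu _ => hup a u ha hu) ?_
      (fun _ _ _ => by simp)
    rw [← ENNReal.coe_toNNReal (measure_ne_top μ Set.univ), ← ENNReal.coe_mul, hφv, mul_assoc,
      inv_mul_cancel₀ hm0.ne', mul_one, ENNReal.coe_inv (by norm_num)]
    simp
  · obtain ⟨p, hp, hlow⟩ := exists_lowerGrowth_of_lowerIndex_pos hα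
    -- On `ℕ` a modular bound of 24 bounds every value by `w`, so only arguments up to `4 * w`
    -- occur.
    obtain ⟨w, hw⟩ := φ.surjective 24
    obtain ⟨c, hc, hlow⟩ := hlow.small_le hp (4 * w)
    obtain ⟨K, hK, hup⟩ := h.small_le hq0 (4 * w)
    refine orliczHasCotype_of_growth (v := 0) (V := ((4 * w : ℝ≥0) : ℝ≥0∞)) hq hp hc hK
      (fun a u ha _ hu => hlow a u ha (ENNReal.coe_le_coe.1 hu))
      (fun a u ha _ hu => hup a u ha (ENNReal.coe_le_coe.1 hu)) (by simp [φ.map_zero'])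
      fun g _ hg => Filter.Eventually.of_forall fun t => ENNReal.coe_le_coe.2 ?_
    rw [lintegral_count] at hg
    have h1 : (φ (g t) : ℝ≥0∞) ≤ 24 := (ENNReal.le_tsum t).trans hg
    have h2 : φ (g t) ≤ φ w := by
      rw [hw]
      exact_mod_cast h1
    exact mul_le_mul_right (φ.strictMono'.le_iff_le.1 h2) 4
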